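/- Let $\lambda\ge 0$, $p,q\ge 0$ with $p+q=1$, $\lambda_1>1$, $\lambda_2>0$. Assume zero interest and dividend rates, and that under the risk-neutral probability measure $\mathbb{P}$, with filtration $(\mathcal F_t)_{t\ge0}$, the underlying $S=(S_t)_{t\ge 0}$ follows a double exponential (Kou) model: $S$ is a positive $(\mathcal F_t)$-martingale whose logarithm is a pure-jump Lévy process relative to $(\mathcal F_t)$ (no Gaussian component; a deterministic linear drift is allowed, the initial value may be $\mathcal F_0$-measurable) with Lévy density $$\eta(x)=\lambda\left(p\lambda_1e^{-\lambda_1x}\mathbf 1_{x\ge0}+q\lambda_2e^{\lambda_2x}\mathbf 1_{x<0}\right).$$ Let $K>0$ and $0\le t\le T$. Then $(S_T-K)^+$ is integrable, and the time-$t$ price $\mathbb{E}[(S_T-K)^+\mid\mathcal F_t]$ of the European call option with strike $K$ and maturity $T$ is almost surely equal to $$S_t\,\Psi\left(-\lambda\zeta,\lambda^*,p^*,\lambda_1^*,\lambda_2^*;\log(K/S_t),T-t\right)-K\,\Psi\left(-\lambda\zeta,\lambda,p,\lambda_1,\lambda_2;\log(K/S_t),T-t\right),$$ where $$\zeta=\frac{p\lambda_1}{\lambda_1-1}+\frac{q\lambda_2}{\lambda_2+1}-1,\quad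 \lambda^*=\lambda(\zeta+1),\quad p^*=\frac{p}{1+\zeta}\cdot\frac{\lambda_1}{\lambda_1-1},\quad \lambda_1^*=\lambda_1-1,\quad\lambda_2^*=\lambda_2+1.$$ The function $\Psi$ is given, with $b=a-\mu\tau$, by $$\begin{aligned}\Psi(\mu,\lambda,p,\lambda_1,\lambda_2;a,\tau)={}&\pi_0\mathbf 1_{b\le0}+\sum_{n=1}^\infty\pi_n\sum_{k=1}^nP_{n,k}\left[\sum_{i=0}^{k-1}\frac{(\lambda_1b)^i}{i!}e^{-\lambda_1b}\mathbf 1_{b\ge0}+\mathbf 1_{b<0}\right]\\&+\sum_{n=1}^\infty\pi_n\sum_{k=1}^nQ_{n,k}\left(1-\sum_{i=0}^{k-1}\frac{(-\lambda_2b)^i}{i!}e^{\lambda_2b}\right)\mathbf 1_{b<0},\end{aligned}$$ with $0^0=1$, $\pi_n=e^{-\lambda\tau}(\lambda\tau)^n/n!$, and, with $q=1-p$ for the parameter $p$ passed to $\Psi$ (so $q=1-p^*$ in the first term of the price), for $1\le k\le n-1$, $$P_{n,k}=\sum_{i=k}^{n-1}\binom{n-k-1}{i-k}\binom ni\left(\frac{\lambda_1}{\lambda_1+\lambda_2}\right)^{i-k}\left(\frac{\lambda_2}{\lambda_1+\lambda_2}\right)^{n-i}p^iq^{n-i},$$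 $$Q_{n,k}=\sum_{i=k}^{n-1}\binom{n-k-1}{i-k}\binom ni\left(\frac{\lambda_1}{\lambda_1+\lambda_2}\right)^{n-i}\left(\frac{\lambda_2}{\lambda_1+\lambda_2}\right)^{i-k}p^{n-i}q^i,$$ and $P_{n,n}=p^n$, $Q_{n,n}=q^n$. For both parameter sets in the price, with $\tau=T-t$, both infinite series in $\Psi$ converge for every $a\in\mathbb R$. -/

import Mathlib

open MeasureTheory ProbabilityTheory Filter Topology
open scoped NNReal ENNReal

noncomputable section

/-! ### Lévy processes with a given characteristic triplet -/

/-- `X` is a Lévy process relative to the filtration `ℱ` under `P`, started from an arbitrary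
(possibly random) initial value `X 0`: it is adapted, its increments after time `s` are independent
of `ℱ s` and stationary, and almost every path is right-continuous with left limits. -/
structure IsLevyProcess {Ω : Type*} {m : MeasurableSpace Ω} (X : ℝ≥0 → Ω → ℝ)
    (ℱ : Filtration ℝ≥0 m) (P : Measure Ω) : Prop where
  adapted : Adapted ℱ X
  indep_increments : ∀ s t : ℝ≥0, s ≤ t →
    Indep (MeasurableSpace.comap (fun ω => X t ω - X s ω) inferInstance) (ℱ s) P
  stationary_increments : ∀ s h : ℝ≥0,
    IdentDistrib (fun ω => X (s + h) ω - X s ω) (fun ω => X h ω - X 0 ω) P P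
  cadlag : ∀ᵐ ω ∂P, ∀ t : ℝ≥0,
    ContinuousWithinAt (fun u => X u ω) (Set.Ici t) t ∧
      ∃ l : ℝ, Tendsto (fun u => X u ω) (𝓝[<] t) (𝓝 l)

/-- `ν` is a Lévy measure on `ℝ`: no mass at `0` and `∫ min(1, x²) ν(dx) < ∞`. -/
def IsLevyMeasure (ν : Measure ℝ) : Prop :=
  ν {0} = 0 ∧ ∫⁻ x, ENNReal.ofReal (min 1 (x ^ 2)) ∂ν < ∞

/-- The Lévy–Khintchine exponent of the characteristic triplet `(γ, σ2, ν)` at `u`: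
`i γ u - σ2 u² / 2 + ∫ (e^{iux} - 1 - i u x 1_{|x| ≤ 1}) ν(dx)`. -/
def levyExponent (γ σ2 : ℝ) (ν : Measure ℝ) (u : ℝ) : ℂ :=
  Complex.I * γ * u - σ2 * u ^ 2 / 2 +
    ∫ x : ℝ, (Complex.exp (Complex.I * u * x) - 1 -
      if |x| ≤ 1 then Complex.I * u * x else 0) ∂ν

/-- The Lévy process `X` has characteristic triplet `(γ, σ2, ν)`: the characteristic function of
`X t - X 0` is `exp (t · levyExponent)`. -/
def HasLevyTriplet {Ω : Type*} {m : MeasurableSpace Ω} (X : ℝ≥0 → Ω → ℝ) (P : Measure Ω)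
    (γ σ2 : ℝ) (ν : Measure ℝ) : Prop :=
  IsLevyMeasure ν ∧ 0 ≤ σ2 ∧
    ∀ (t : ℝ≥0) (u : ℝ), charFun (P.map (fun ω => X t ω - X 0 ω)) u =
      Complex.exp (((t : ℝ) : ℂ) * levyExponent γ σ2 ν u)

/-- `X` is a pure-jump Lévy process (no Gaussian component; a deterministic linear drift is
allowed) with Lévy density `η`. -/
def IsPureJumpLevyWithDensity {Ω : Type*} {m : MeasurableSpace Ω} (X : ℝ≥0 → Ω → ℝ)
    (ℱ : Filtration ℝ≥0 m) (P : Measure Ω) (η : ℝ → ℝ) : Prop :=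
  IsLevyProcess X ℱ P ∧
    ∃ γ : ℝ, HasLevyTriplet X P γ 0 (volume.withDensity fun x => ENNReal.ofReal (η x))

/-! ### The double exponential (Kou) model -/

/-- The double exponential Lévy density
`η(x) = lam (p l₁ e^{-l₁ x} 1_{x ≥ 0} + q l₂ e^{l₂ x} 1_{x < 0})`. -/
def kouDensity (lam p q l₁ l₂ : ℝ) (x : ℝ) : ℝ :=
  lam * (if 0 ≤ x then p * l₁ * Real.exp (-l₁ * x) else q * l₂ * Real.exp (l₂ * x))

/-- `S` follows a double exponential model under the risk-neutral measure `P`, with zero interest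
and dividend rates: it is a positive martingale whose logarithm is a pure-jump Lévy process with
double exponential Lévy density. The drift is not prescribed; it is forced by the martingale
property. -/
structure IsKouModel {Ω : Type*} {m : MeasurableSpace Ω} (S : ℝ≥0 → Ω → ℝ)
    (ℱ : Filtration ℝ≥0 m) (P : Measure Ω) (lam p q l₁ l₂ : ℝ) : Prop where
  pos : ∀ t ω, 0 < S t ω
  martingale : Martingale S ℱ P
  log_levy : IsPureJumpLevyWithDensity (fun t ω => Real.log (S t ω)) ℱ P
    (kouDensity lam p q l₁ l₂)

/-- The time-`t` price of the European call with strike `K` and maturity `T`, at zero interest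
rate: the risk-neutral conditional expectation of the payoff `(S_T - K)⁺`. -/
def callPrice {Ω : Type*} {m : MeasurableSpace Ω} (S : ℝ≥0 → Ω → ℝ)
    (ℱ : Filtration ℝ≥0 m) (P : Measure Ω) (K : ℝ) (T t : ℝ≥0) : Ω → ℝ :=
  P[fun ω => max (S T ω - K) 0 | ℱ t]

/-! ### The function `Ψ` -/

/-- The coefficient `P_{n,k}`, `1 ≤ k ≤ n`, with `q = 1 - p`. -/
def kouP (p l₁ l₂ : ℝ) (n k : ℕ) : ℝ :=
  if k = n then p ^ n
  else ∑ i ∈ Finset.Icc k (n - 1), ((n - k - 1).choose (i - k) : ℝ) * (n.choose i : ℝ) *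
    (l₁ / (l₁ + l₂)) ^ (i - k) * (l₂ / (l₁ + l₂)) ^ (n - i) * p ^ i * (1 - p) ^ (n - i)

/-- The coefficient `Q_{n,k}`, `1 ≤ k ≤ n`, with `q = 1 - p`. -/
def kouQ (p l₁ l₂ : ℝ) (n k : ℕ) : ℝ :=
  if k = n then (1 - p) ^ n
  else ∑ i ∈ Finset.Icc k (n - 1), ((n - k - 1).choose (i - k) : ℝ) * (n.choose i : ℝ) *
    (l₁ / (l₁ + l₂)) ^ (n - i) * (l₂ / (l₁ + l₂)) ^ (i - k) * p ^ (n - i) * (1 - p) ^ i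

/-- The Poisson weight `π_n = e^{-lam T} (lam T)^n / n!`. -/
def kouWeight (lam T : ℝ) (n : ℕ) : ℝ :=
  Real.exp (-(lam * T)) * (lam * T) ^ n / (n.factorial : ℝ)

/-- The `n`-th term (`n ≥ 1`) of the first series in `Ψ`; here `b = a - μ T`. -/
def kouPosTerm (lam p l₁ l₂ b T : ℝ) (n : ℕ) : ℝ :=
  kouWeight lam T n * ∑ k ∈ Finset.Icc 1 n, kouP p l₁ l₂ n k *
    ((∑ i ∈ Finset.range k, (l₁ * b) ^ i / (i.factorial : ℝ) * Real.exp (-(l₁ * b))) *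
        (if 0 ≤ b then 1 else 0) + (if b < 0 then 1 else 0))

/-- The `n`-th term (`n ≥ 1`) of the second series in `Ψ`; here `b = a - μ T`. -/
def kouNegTerm (lam p l₁ l₂ b T : ℝ) (n : ℕ) : ℝ :=
  kouWeight lam T n * ∑ k ∈ Finset.Icc 1 n, kouQ p l₁ l₂ n k *
    (1 - ∑ i ∈ Finset.range k, (-(l₂ * b)) ^ i / (i.factorial : ℝ) * Real.exp (l₂ * b)) *
      (if b < 0 then 1 else 0)

/-- `Ψ(μ, lam, p, l₁, l₂; a, T)`. The series over `n ≥ 1` are indexed by `n + 1`, `n ≥ 0`. -/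
def kouPsi (μ lam p l₁ l₂ a T : ℝ) : ℝ :=
  kouWeight lam T 0 * (if a - μ * T ≤ 0 then 1 else 0) +
    ∑' n : ℕ, kouPosTerm lam p l₁ l₂ (a - μ * T) T (n + 1) +
    ∑' n : ℕ, kouNegTerm lam p l₁ l₂ (a - μ * T) T (n + 1)

/-- The two series in `Ψ(μ, lam, p, l₁, l₂; a, T)` converge. -/
def KouPsiConverges (μ lam p l₁ l₂ a T : ℝ) : Prop :=
  (Summable fun n : ℕ => kouPosTerm lam p l₁ l₂ (a - μ * T) T (n + 1)) ∧
    Summable fun n : ℕ => kouNegTerm lam p l₁ l₂ (a - μ * T) T (n + 1)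

/-- `ζ = p l₁ / (l₁ - 1) + q l₂ / (l₂ + 1) - 1`. -/
def kouZeta (p q l₁ l₂ : ℝ) : ℝ := p * l₁ / (l₁ - 1) + q * l₂ / (l₂ + 1) - 1

/-- `p* = p / (1 + ζ) · l₁ / (l₁ - 1)`. -/
def kouPStar (p q l₁ l₂ : ℝ) : ℝ := p / (1 + kouZeta p q l₁ l₂) * (l₁ / (l₁ - 1))

/-- `lam* = lam (ζ + 1)`. -/
def kouLamStar (lam p q l₁ l₂ : ℝ) : ℝ := lam * (kouZeta p q l₁ l₂ + 1)

end

/-! ### Gamma distributions of integer shape -/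

/-! The log-return `D = log S_T - log S_t` is independent of `ℱ t`, and since the Lévy measure is
finite its law is that of a drift plus a compound Poisson variable (`exists_map_eq_kouLaw_map_add`).
A sum of `n` double exponential jumps is a mixture of gamma laws and reflected gamma laws with
weights `P_{n,k}`, `Q_{n,k}`. The factors `A = l₁ / (l₁ - iu)` and `B = l₂ / (l₂ + iu)` satisfy `A B
= α A + β B` with `α = l₂ / (l₁ + l₂)` and `β = l₁ / (l₁ + l₂)`, so partial fractions expand `(p A +
(1 - p) B) ^ n` into pure powers of `A` and `B` (`sum_kouP_kouQ_mul_pow`). The mixture `kouLaw` is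
therefore written down directly and identified by `charFun_kouLaw`. Its tails are the series in `Ψ`
(`kouPsi_eq_kouLaw_real_Ici`).

Tilting by `exp x` keeps this family of laws, with the starred parameters
(`kouLaw_withDensity_exp`). The martingale property gives `E[exp D] = 1`, which fixes the drift over
`[t, T]` and normalises the tilted law (`drift_and_tilt_of_lintegral_exp_eq_one`).

Freezing `S_t` by independence (`condExp_comp_prodMk_of_indep`) gives the price `S_t E[exp D; D ≥ a]
- K P(D ≥ a)` with `a = log (K / S_t)`: a tail of the tilted law and a tail of the original one. -/

lemma gammaPDFReal_natCast_succ (j : ℕ) (l x : ℝ) :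
    gammaPDFReal ((j + 1 : ℕ) : ℝ) l x =
      if 0 ≤ x then l ^ (j + 1) / (j.factorial : ℝ) * x ^ j * Real.exp (-(l * x)) else 0 := by
  unfold gammaPDFReal
  have h : (((j + 1 : ℕ) : ℝ) - 1) = (j : ℝ) := by push_cast; ring
  rw [h, Real.rpow_natCast, Real.rpow_natCast, Nat.cast_succ, Real.Gamma_nat_eq_factorial]

/-- Differentiating a truncated exponential series drops its top term, so the product rule
telescopes. The rate is complex so that one antiderivative serves both the tails (`r = l`) and the
characteristic function (`r = l - iu`). -/
lemma hasDerivAt_exp_neg_mul_sum (j : ℕ) (r : ℂ) (x : ℝ) :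
    HasDerivAt (fun x : ℝ => -(Complex.exp (-(r * x)) *
        ∑ i ∈ Finset.range (j + 1), (r * x) ^ i / (i.factorial : ℂ)))
      (r ^ (j + 1) / (j.factorial : ℂ) * (x : ℂ) ^ j * Complex.exp (-(r * x))) x := by
  have hx : HasDerivAt (fun x : ℝ => r * (x : ℂ)) r x := by
    simpa using (Complex.ofRealCLM.hasDerivAt (x := x)).const_mul r
  have he : HasDerivAt (fun x : ℝ => Complex.exp (-(r * x)))
      (Complex.exp (-(r * x)) * (-r)) x := hx.neg.cexp
  have hs : HasDerivAt (fun x : ℝ => ∑ i ∈ Finset.range (j + 1), (r * x) ^ i / (i.factorial : ℂ))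
      (r * ∑ i ∈ Finset.range j, (r * x) ^ i / (i.factorial : ℂ)) x := by
    induction j with
    | zero => simpa using hasDerivAt_const x (1 : ℂ)
    | succ j ih =>
      have h2 := ih.add ((hx.pow (j + 1)).div_const ((j + 1).factorial : ℂ))
      have e : (fun x : ℝ => ∑ i ∈ Finset.range (j + 1 + 1), (r * x) ^ i / (i.factorial : ℂ)) =
        (fun x : ℝ => ∑ i ∈ Finset.range (j + 1), (r * x) ^ i / (i.factorial : ℂ)) +
          fun x : ℝ => (r * x) ^ (j + 1) / ((j + 1).factorial : ℂ) := by
        ext y; simp [Finset.sum_range_succ]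
      rw [e]
      refine h2.congr_deriv ?_
      rw [Finset.sum_range_succ, mul_add]
      congr 1
      rw [Nat.factorial_succ]
      have : (j.factorial : ℂ) ≠ 0 := by exact_mod_cast j.factorial_ne_zero
      have h' : ((j : ℂ) + 1) ≠ 0 := by exact_mod_cast j.succ_ne_zero
      push_cast
      field_simp
  refine (he.mul hs).neg.congr_deriv ?_
  rw [Finset.sum_range_succ]
  ring

lemma tendsto_exp_neg_mul_sum (j : ℕ) {r : ℂ} (hr : 0 < r.re) :
    Tendsto (fun x : ℝ => -(Complex.exp (-(r * x)) *
        ∑ i ∈ Finset.range (j + 1), (r * x) ^ i / (i.factorial : ℂ))) atTop (𝓝 0) := by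
  have h : ∀ i : ℕ, Tendsto (fun x : ℝ => Complex.exp (-(r * x)) *
      ((r * x) ^ i / (i.factorial : ℂ))) atTop (𝓝 0) := by
    intro i
    rw [tendsto_zero_iff_norm_tendsto_zero]
    have := (tendsto_rpow_mul_exp_neg_mul_atTop_nhds_zero i r.re hr).const_mul
      (‖r‖ ^ i / (i.factorial : ℝ))
    rw [mul_zero] at this
    refine this.congr' ?_
    filter_upwards [eventually_ge_atTop 0] with x hx
    rw [norm_mul, Complex.norm_exp, norm_div, norm_pow, norm_mul, Complex.norm_real,
      Real.norm_of_nonneg hx, Real.rpow_natCast]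
    simp
    ring
  have := (tendsto_finsetSum (Finset.range (j + 1)) fun i _ => h i).neg
  simpa [Finset.mul_sum] using this

lemma integrableOn_pow_mul_cexp_neg_mul (j : ℕ) {r : ℂ} (hr : 0 < r.re) :
    IntegrableOn (fun x : ℝ => (x : ℂ) ^ j * Complex.exp (-(r * x))) (Set.Ioi 0) := by
  have h := integrableOn_rpow_mul_exp_neg_mul_rpow (p := 1) (s := j) (b := r.re)
    (by have : (0 : ℝ) ≤ j := j.cast_nonneg
        linarith) one_pos hr
  refine Integrable.mono h ?_ ?_
  · exact Continuous.aestronglyMeasurable (by fun_prop)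
  · refine (ae_restrict_iff' measurableSet_Ioi).mpr (ae_of_all _ fun x (hx : 0 < x) => ?_)
    rw [norm_mul, norm_mul, Complex.norm_exp, norm_pow, Complex.norm_real, Real.rpow_natCast,
      Real.rpow_one, norm_pow, Real.norm_of_nonneg (Real.exp_pos _).le]
    simp

lemma integral_Ioi_pow_mul_cexp_neg_mul (j : ℕ) {r : ℂ} (hr : 0 < r.re) {b : ℝ} (hb : 0 ≤ b) :
    ∫ x in Set.Ioi b, r ^ (j + 1) / (j.factorial : ℂ) * (x : ℂ) ^ j * Complex.exp (-(r * x)) =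
      Complex.exp (-(r * b)) * ∑ i ∈ Finset.range (j + 1), (r * b) ^ i / (i.factorial : ℂ) := by
  rw [integral_Ioi_of_hasDerivAt_of_tendsto' (fun x _ => hasDerivAt_exp_neg_mul_sum j r x) ?_
    (tendsto_exp_neg_mul_sum j hr)]
  · ring
  · have := ((integrableOn_pow_mul_cexp_neg_mul j hr).mono_set
      (Set.Ioi_subset_Ioi hb)).const_mul (r ^ (j + 1) / (j.factorial : ℂ))
    simpa only [IntegrableOn, mul_assoc] using this

lemma gammaMeasure_real_Ici (j : ℕ) {l : ℝ} (hl : 0 < l) {b : ℝ} (hb : 0 ≤ b) :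
    (gammaMeasure ((j + 1 : ℕ) : ℝ) l).real (Set.Ici b) =
      ∑ i ∈ Finset.range (j + 1), (l * b) ^ i / (i.factorial : ℝ) * Real.exp (-(l * b)) := by
  have hj : (0 : ℝ) < ((j + 1 : ℕ) : ℝ) := by positivity
  have h1 := integral_Ioi_pow_mul_cexp_neg_mul j (r := (l : ℂ)) (by simpa using hl) hb
  rw [gammaMeasure, measureReal_def, withDensity_apply _ measurableSet_Ici]
  unfold gammaPDF
  rw [← integral_eq_lintegral_of_nonneg_ae
    (ae_of_all _ fun x => gammaPDFReal_nonneg hj hl x) (by fun_prop), integral_Ici_eq_integral_Ioi]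
  apply Complex.ofReal_injective
  rw [← integral_complex_ofReal]
  refine Eq.trans (setIntegral_congr_fun measurableSet_Ioi fun x hx => ?_) (h1.trans ?_)
  · rw [gammaPDFReal_natCast_succ, if_pos (hb.trans (le_of_lt hx))]
    push_cast
    rfl
  · push_cast
    rw [Finset.mul_sum]
    exact Finset.sum_congr rfl fun i _ => mul_comm _ _

lemma gammaMeasure_Iio_zero (a r : ℝ) : gammaMeasure a r (Set.Iio 0) = 0 := by
  rw [gammaMeasure, withDensity_apply _ measurableSet_Iio]
  exact lintegral_gammaPDF_of_nonpos le_rfl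

lemma gammaMeasure_real_Ici_of_nonpos {a r : ℝ} (ha : 0 < a) (hr : 0 < r) {b : ℝ} (hb : b ≤ 0) :
    (gammaMeasure a r).real (Set.Ici b) = 1 := by
  have := isProbabilityMeasure_gammaMeasure ha hr
  have h : (gammaMeasure a r).real (Set.Ici b)ᶜ = 0 := by
    rw [Set.compl_Ici, measureReal_def, measure_mono_null (Set.Iio_subset_Iio hb)
      (gammaMeasure_Iio_zero a r), ENNReal.toReal_zero]
  rw [probReal_compl_eq_one_sub measurableSet_Ici] at h
  linarith

lemma charFun_gammaMeasure_natCast_succ (j : ℕ) {l : ℝ} (hl : 0 < l) (u : ℝ) :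
    charFun (gammaMeasure ((j + 1 : ℕ) : ℝ) l) u =
      ((l : ℂ) / (l - u * Complex.I)) ^ (j + 1) := by
  have hj : (0 : ℝ) < ((j + 1 : ℕ) : ℝ) := by positivity
  set r : ℂ := l - u * Complex.I with hr
  have hre : 0 < r.re := by simpa [hr] using hl
  have hr0 : r ≠ 0 := fun h => by simp [h] at hre
  have h1 := integral_Ioi_pow_mul_cexp_neg_mul j hre le_rfl
  -- At `b = 0` only the term `i = 0` survives, with `0 ^ 0 = 1`.
  have h2 : ∑ i ∈ Finset.range (j + 1), (r * ((0 : ℝ) : ℂ)) ^ i / (i.factorial : ℂ) = 1 := by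
    rw [Finset.sum_range_succ']
    simp
  rw [h2] at h1
  rw [charFun_apply_real, gammaMeasure, integral_withDensity_eq_integral_toReal_smul
    (f := gammaPDF _ l) (measurable_gammaPDFReal _ _).ennreal_ofReal (ae_of_all _ fun x => ENNReal.ofReal_lt_top)]
  have h3 : ∀ x : ℝ, (gammaPDF ((j + 1 : ℕ) : ℝ) l x).toReal • Complex.exp (u * x * Complex.I) =
      (Set.Ici (0 : ℝ)).indicator (fun x : ℝ => ((l : ℂ) / r) ^ (j + 1) *
        (r ^ (j + 1) / (j.factorial : ℂ) * (x : ℂ) ^ j * Complex.exp (-(r * x)))) x := by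
    intro x
    rw [gammaPDF, ENNReal.toReal_ofReal (gammaPDFReal_nonneg hj hl x), gammaPDFReal_natCast_succ]
    by_cases hx : 0 ≤ x
    · rw [Set.indicator_of_mem (Set.mem_Ici.mpr hx), if_pos hx, Complex.real_smul]
      have : Complex.exp (-(r * x)) =
          Complex.exp (-(l * x)) * Complex.exp (u * x * Complex.I) := by
        rw [← Complex.exp_add]; congr 1; rw [hr]; ring
      rw [this, div_pow]
      push_cast
      field_simp
    · rw [Set.indicator_of_notMem (by simpa using hx), if_neg hx, zero_smul]
  rw [integral_congr_ae (ae_of_all _ h3), integral_indicator measurableSet_Ici,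
    integral_Ici_eq_integral_Ioi, integral_const_mul, h1]
  simp

/-- Tilting a gamma distribution by `exp (s x)`. -/
lemma gammaMeasure_withDensity_exp (j : ℕ) {l s : ℝ} (hl : 0 < l) (hs : s < l) :
    (gammaMeasure ((j + 1 : ℕ) : ℝ) l).withDensity (fun x => ENNReal.ofReal (Real.exp (s * x))) =
      ENNReal.ofReal ((l / (l - s)) ^ (j + 1)) • gammaMeasure ((j + 1 : ℕ) : ℝ) (l - s) := by
  have hj : (0 : ℝ) < ((j + 1 : ℕ) : ℝ) := by positivity
  have hls : 0 < l - s := sub_pos.mpr hs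
  have hm : ∀ l, Measurable (gammaPDF ((j + 1 : ℕ) : ℝ) l) := fun l =>
    (measurable_gammaPDFReal _ _).ennreal_ofReal
  rw [gammaMeasure, gammaMeasure, ← withDensity_mul _ (hm _) (by fun_prop),
    ← withDensity_smul _ (hm _)]
  congr 1
  ext x
  simp only [Pi.mul_apply, Pi.smul_apply, smul_eq_mul, gammaPDF]
  rw [← ENNReal.ofReal_mul (gammaPDFReal_nonneg hj hl x), ← ENNReal.ofReal_mul (by positivity),
    gammaPDFReal_natCast_succ, gammaPDFReal_natCast_succ]
  congr 1
  split_ifs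
  · have : Real.exp (-((l - s) * x)) = Real.exp (-(l * x)) * Real.exp (s * x) := by
      rw [← Real.exp_add]; congr 1; ring
    rw [this, div_pow]
    field_simp
  · simp

/-! ### Partial fractions and the coefficients `P_{n,k}`, `Q_{n,k}` -/

/-- Pascal's rule, in the form matching the recursion `A^(i+1) B^(j+1) = α A^(i+1) B^j + β A^i
B^(j+1)` on the coefficients of the powers of `A`. -/
lemma sum_choose_mul_pow_succ {R : Type*} [CommRing R] (α β A : R) (i j : ℕ) :
    ∑ k ∈ Finset.Icc 1 (i + 1), ((i + 1 + (j + 1) - k - 1).choose (i + 1 - k) : R) *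
        β ^ (i + 1 - k) * α ^ (j + 1) * A ^ k =
      α * ∑ k ∈ Finset.Icc 1 (i + 1), ((i + 1 + j - k - 1).choose (i + 1 - k) : R) *
        β ^ (i + 1 - k) * α ^ j * A ^ k +
      β * ∑ k ∈ Finset.Icc 1 i, ((i + (j + 1) - k - 1).choose (i - k) : R) *
        β ^ (i - k) * α ^ (j + 1) * A ^ k := by
  rw [Finset.sum_Icc_succ_top (by omega), Finset.sum_Icc_succ_top (by omega), mul_add,
    Finset.mul_sum, Finset.mul_sum, add_right_comm (Finset.sum _ _), ← Finset.sum_add_distrib]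
  congr 1
  · refine Finset.sum_congr rfl fun k hk => ?_
    obtain ⟨d, rfl⟩ := Nat.exists_eq_add_of_le (Finset.mem_Icc.mp hk).2
    have h1 : k + d + 1 + (j + 1) - k - 1 = d + j + 1 := by omega
    have h2 : k + d + 1 - k = d + 1 := by omega
    have h3 : k + d + 1 + j - k - 1 = d + j := by omega
    have h4 : k + d + (j + 1) - k - 1 = d + j := by omega
    have h5 : k + d - k = d := by omega
    rw [h1, h2, h3, h4, h5, Nat.choose_succ_succ]
    push_cast
    ring
  · simp
    ring

/-- The partial fraction expansion of `A ^ i * B ^ j` when `A * B = α * A + β * B`. -/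
lemma pow_mul_pow_eq_sum_add_sum {R : Type*} [CommRing R] {A B α β : R}
    (h : A * B = α * A + β * B) : ∀ i j : ℕ, i + j ≠ 0 →
    A ^ i * B ^ j =
      ∑ k ∈ Finset.Icc 1 i, ((i + j - k - 1).choose (i - k) : R) * β ^ (i - k) * α ^ j * A ^ k +
      ∑ k ∈ Finset.Icc 1 j, ((j + i - k - 1).choose (j - k) : R) * α ^ (j - k) * β ^ i * B ^ k := by
  -- Boundary case of a zero exponent: the binomial vanishes for `k ≤ i`, and at `k = i + 1`
  -- truncated subtraction makes it `choose 0 0 = 1`.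
  have edge : ∀ (i : ℕ) (α A : R),
      A ^ (i + 1) = ∑ k ∈ Finset.Icc 1 (i + 1), ((i + 1 - k - 1).choose (i + 1 - k) : R) *
        α ^ (i + 1 - k) * A ^ k := by
    intro i α A
    rw [Finset.sum_Icc_succ_top (by omega), Finset.sum_eq_zero]
    · simp
    · intro k hk
      rw [Nat.choose_eq_zero_of_lt (by have := (Finset.mem_Icc.mp hk).2; omega)]
      simp
  intro i
  induction i with
  | zero =>
    intro j hj
    obtain ⟨j, rfl⟩ := Nat.exists_eq_succ_of_ne_zero (by omega : j ≠ 0)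
    simpa using edge j α B
  | succ i ihi =>
    intro j
    induction j with
    | zero => intro _; simpa using edge i β A
    | succ j ihj =>
      intro _
      rw [sum_choose_mul_pow_succ α β A i j, sum_choose_mul_pow_succ β α B j i]
      have e : A ^ (i + 1) * B ^ (j + 1) =
          α * (A ^ (i + 1) * B ^ j) + β * (A ^ i * B ^ (j + 1)) := by
        rw [pow_succ, pow_succ]
        linear_combination A ^ i * B ^ j * h
      rw [e, ihj (by omega), ihi (j + 1) (by omega)]
      ring

lemma kouQ_eq_kouP (p l₁ l₂ : ℝ) (n k : ℕ) : kouQ p l₁ l₂ n k = kouP (1 - p) l₂ l₁ n k := by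
  unfold kouQ kouP
  rw [add_comm l₂ l₁, sub_sub_cancel]
  split_ifs
  · rfl
  · exact Finset.sum_congr rfl fun i _ => by ring

/-- Extending the sum to `i = n` merges the two cases: the added binomial `choose (n-k-1) (n-k)` is
`0` for `k < n`, and for `k = n` truncated subtraction turns it into `choose 0 0 = 1`. -/
lemma kouP_eq_sum (p l₁ l₂ : ℝ) {n k : ℕ} (hk : 1 ≤ k) (hkn : k ≤ n) :
    kouP p l₁ l₂ n k = ∑ i ∈ Finset.Icc k n, ((n - k - 1).choose (i - k) : ℝ) * (n.choose i : ℝ) *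
      (l₁ / (l₁ + l₂)) ^ (i - k) * (l₂ / (l₁ + l₂)) ^ (n - i) * p ^ i * (1 - p) ^ (n - i) := by
  unfold kouP
  split_ifs with h
  · subst h; simp
  · obtain ⟨m, rfl⟩ := Nat.exists_eq_succ_of_ne_zero (by omega : n ≠ 0)
    rw [Nat.succ_eq_add_one, Finset.sum_Icc_succ_top (by omega),
      Nat.choose_eq_zero_of_lt (n := m + 1 - k - 1) (by omega)]
    simp

lemma kouP_nonneg {p l₁ l₂ : ℝ} (hp : 0 ≤ p) (hp1 : p ≤ 1) (hl₁ : 0 ≤ l₁) (hl₂ : 0 ≤ l₂)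
    (n k : ℕ) : 0 ≤ kouP p l₁ l₂ n k := by
  have := sub_nonneg.mpr hp1
  unfold kouP
  split_ifs
  · positivity
  · exact Finset.sum_nonneg fun i _ => by positivity

lemma kouQ_nonneg {p l₁ l₂ : ℝ} (hp : 0 ≤ p) (hp1 : p ≤ 1) (hl₁ : 0 ≤ l₁) (hl₂ : 0 ≤ l₂)
    (n k : ℕ) : 0 ≤ kouQ p l₁ l₂ n k := by
  rw [kouQ_eq_kouP]
  exact kouP_nonneg (sub_nonneg.mpr hp1) (by linarith) hl₂ hl₁ n k

/-- `P_{n,k}` averages, over the binomial number `i` of upward jumps, the coefficient of `A ^ k` in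
the expansion of `A ^ i * B ^ (n - i)`; only the order of summation changes. -/
lemma sum_kouP_mul_pow (p l₁ l₂ : ℝ) (A : ℂ) (n : ℕ) :
    ∑ k ∈ Finset.Icc 1 n, (kouP p l₁ l₂ n k : ℂ) * A ^ k =
      ∑ i ∈ Finset.range (n + 1), ((p : ℂ) ^ i * (1 - p) ^ (n - i) * (n.choose i : ℂ)) *
        ∑ k ∈ Finset.Icc 1 i, ((i + (n - i) - k - 1).choose (i - k) : ℂ) *
          ((l₁ / (l₁ + l₂) : ℝ) : ℂ) ^ (i - k) * ((l₂ / (l₁ + l₂) : ℝ) : ℂ) ^ (n - i) * A ^ k := by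
  simp_rw [Finset.mul_sum]
  rw [Finset.sum_comm' (t' := Finset.Icc 1 n) (s' := fun k => Finset.Icc k n)
    (by intro x y; simp only [Finset.mem_range, Finset.mem_Icc]; omega)]
  refine Finset.sum_congr rfl fun k hk => ?_
  obtain ⟨hk1, hk2⟩ := Finset.mem_Icc.mp hk
  rw [kouP_eq_sum p l₁ l₂ hk1 hk2]
  push_cast
  rw [Finset.sum_mul]
  refine Finset.sum_congr rfl fun i hi => ?_
  rw [show i + (n - i) = n by have := (Finset.mem_Icc.mp hi).2; omega]
  ring

/-- The generating identity of the coefficients `P_{n,k}` and `Q_{n,k}`. -/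
lemma sum_kouP_kouQ_mul_pow (p : ℝ) {l₁ l₂ : ℝ} {A B : ℂ}
    (h : A * B = ((l₂ / (l₁ + l₂) : ℝ) : ℂ) * A + ((l₁ / (l₁ + l₂) : ℝ) : ℂ) * B)
    {n : ℕ} (hn : n ≠ 0) :
    ∑ k ∈ Finset.Icc 1 n, ((kouP p l₁ l₂ n k : ℂ) * A ^ k + (kouQ p l₁ l₂ n k : ℂ) * B ^ k) =
      (p * A + (1 - p) * B) ^ n := by
  simp_rw [kouQ_eq_kouP]
  -- In the second sum the index counts downward jumps; reflecting it lets both sums run over the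
  -- number of upward jumps.
  rw [Finset.sum_add_distrib, sum_kouP_mul_pow, sum_kouP_mul_pow, add_pow,
    ← Finset.sum_range_reflect (n := n + 1) (f := fun i => (((1 - p : ℝ) : ℂ) ^ i *
      (1 - ((1 - p : ℝ) : ℂ)) ^ (n - i) * (n.choose i : ℂ)) * _), ← Finset.sum_add_distrib]
  refine Finset.sum_congr rfl fun i hi => ?_
  have hi' : i ≤ n := by have := Finset.mem_range.mp hi; omega
  have h1 : n + 1 - 1 - i = n - i := by omega
  have h2 : n - (n - i) = i := by omega
  have h3 : 1 - ((1 - p : ℝ) : ℂ) = p := by push_cast; ring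
  rw [h1, h2, h3, Nat.choose_symm hi', mul_pow, mul_pow,
    show (p : ℂ) ^ i * A ^ i * ((1 - p) ^ (n - i) * B ^ (n - i)) * (n.choose i : ℂ) =
      (p : ℂ) ^ i * (1 - p) ^ (n - i) * (n.choose i : ℂ) * (A ^ i * B ^ (n - i)) by ring,
    pow_mul_pow_eq_sum_add_sum h i (n - i) (by omega), mul_add, add_comm l₂ l₁]
  congr 1
  push_cast
  ring

lemma sum_kouP_kouQ (p : ℝ) {l₁ l₂ : ℝ} (h : l₁ + l₂ ≠ 0) {n : ℕ} (hn : n ≠ 0) :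
    ∑ k ∈ Finset.Icc 1 n, (kouP p l₁ l₂ n k + kouQ p l₁ l₂ n k) = 1 := by
  have h1 : l₂ / (l₁ + l₂) + l₁ / (l₁ + l₂) = 1 := by field_simp; ring
  have := sum_kouP_kouQ_mul_pow p (l₁ := l₁) (l₂ := l₂) (A := 1) (B := 1)
    (by rw [mul_one, mul_one, mul_one, ← Complex.ofReal_add, h1, Complex.ofReal_one]) hn
  simp only [one_pow, mul_one] at this
  rw [show (p : ℂ) + (1 - p) = 1 by ring, one_pow] at this
  exact_mod_cast this

/-- Scaling of `P_{n,k}` under a change of rates that keeps their sum. -/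
lemma pow_mul_kouP_of_add_eq {p p' l₁ l₂ l₁' l₂' z : ℝ} (h3 : l₁' ≠ 0) (h4 : l₂' ≠ 0)
    (hl : l₁' + l₂' = l₁ + l₂)
    (hp : z * p' = p * (l₁ / l₁')) (hq : z * (1 - p') = (1 - p) * (l₂ / l₂'))
    {n k : ℕ} (hk : 1 ≤ k) (hkn : k ≤ n) :
    z ^ n * kouP p' l₁' l₂' n k = (l₁ / l₁') ^ k * kouP p l₁ l₂ n k := by
  rw [kouP_eq_sum _ _ _ hk hkn, kouP_eq_sum _ _ _ hk hkn, Finset.mul_sum, Finset.mul_sum]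
  refine Finset.sum_congr rfl fun i hi => ?_
  obtain ⟨hi1, hi2⟩ := Finset.mem_Icc.mp hi
  obtain ⟨d, rfl⟩ := Nat.exists_eq_add_of_le hi1
  obtain ⟨e, rfl⟩ := Nat.exists_eq_add_of_le hi2
  have h1 : k + d - k = d := by omega
  have h2 : k + d + e - (k + d) = e := by omega
  rw [h1, h2, hl]
  -- Here `k + d` counts upward jumps and `e` downward ones. `e1` produces the ratios `l₁ / l₁'` and
  -- `l₂ / l₂'` to these powers; since `l₁ + l₂` is unchanged, `e2` absorbs all but `(l₁ / l₁') ^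
  -- k`.
  have e1 : z ^ (k + d + e) * (p' ^ (k + d) * (1 - p') ^ e) =
      (p * (l₁ / l₁')) ^ (k + d) * ((1 - p) * (l₂ / l₂')) ^ e := by
    rw [← hp, ← hq, mul_pow, mul_pow]; ring
  have e2 : (l₁' / (l₁ + l₂)) ^ d * (l₂' / (l₁ + l₂)) ^ e *
      ((l₁ / l₁') ^ d * (l₂ / l₂') ^ e) =
      (l₁ / (l₁ + l₂)) ^ d * (l₂ / (l₁ + l₂)) ^ e := by
    rw [mul_mul_mul_comm, ← mul_pow, ← mul_pow]
    congr 2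
    · rw [div_mul_div_comm, mul_comm l₁', mul_div_mul_right _ _ h3]
    · rw [div_mul_div_comm, mul_comm l₂', mul_div_mul_right _ _ h4]
  rw [mul_pow, mul_pow] at e1
  linear_combination
    (((k + d + e - k - 1).choose d : ℝ) * ((k + d + e).choose (k + d) : ℝ) *
      (l₁' / (l₁ + l₂)) ^ d * (l₂' / (l₁ + l₂)) ^ e) * e1 +
    (((k + d + e - k - 1).choose d : ℝ) * ((k + d + e).choose (k + d) : ℝ) *
      p ^ (k + d) * (1 - p) ^ e * (l₁ / l₁') ^ k) * e2

/-! ### Reflected gamma distributions -/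

lemma gammaMeasure_real_Ici_natCast {k : ℕ} (hk : 1 ≤ k) {l : ℝ} (hl : 0 < l) (b : ℝ) :
    (gammaMeasure k l).real (Set.Ici b) =
      (∑ i ∈ Finset.range k, (l * b) ^ i / (i.factorial : ℝ) * Real.exp (-(l * b))) *
        (if 0 ≤ b then 1 else 0) + (if b < 0 then 1 else 0) := by
  obtain ⟨j, rfl⟩ := Nat.exists_eq_succ_of_ne_zero (by omega : k ≠ 0)
  rcases lt_or_ge b 0 with hb | hb
  · rw [gammaMeasure_real_Ici_of_nonpos (by positivity) hl hb.le, if_neg hb.not_ge, if_pos hb]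
    simp
  · rw [if_pos hb, if_neg hb.not_gt, Nat.succ_eq_add_one, gammaMeasure_real_Ici j hl hb]
    simp

lemma gammaMeasure_map_neg_real_Ici_natCast {k : ℕ} (hk : 1 ≤ k) {l : ℝ} (hl : 0 < l) (b : ℝ) :
    ((gammaMeasure k l).map Neg.neg).real (Set.Ici b) =
      (1 - ∑ i ∈ Finset.range k, (-(l * b)) ^ i / (i.factorial : ℝ) * Real.exp (l * b)) *
        (if b < 0 then 1 else 0) := by
  have hk0 : (0 : ℝ) < k := by exact_mod_cast hk
  have := isProbabilityMeasure_gammaMeasure hk0 hl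
  have h1 : ((gammaMeasure k l).map Neg.neg).real (Set.Ici b) =
      1 - (gammaMeasure k l).real (Set.Ici (-b)) := by
    rw [measureReal_def, Measure.map_apply measurable_neg measurableSet_Ici, ← measureReal_def,
      ← probReal_compl_eq_one_sub measurableSet_Ici]
    refine measureReal_congr ?_
    have h2 : Neg.neg ⁻¹' Set.Ici b = Set.Iic (-b) := by
      ext x; simp only [Set.mem_preimage, Set.mem_Ici, Set.mem_Iic]; constructor <;> intro <;> linarith
    rw [h2, Set.compl_Ici]
    -- The gamma law has a density, so the endpoint carries no mass.
    exact (withDensity_absolutelyContinuous _ _).ae_eq Iio_ae_eq_Iic.symm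
  rw [h1]
  rcases lt_or_ge b 0 with hb | hb
  · obtain ⟨j, rfl⟩ := Nat.exists_eq_succ_of_ne_zero (by omega : k ≠ 0)
    rw [if_pos hb, Nat.succ_eq_add_one, gammaMeasure_real_Ici j hl (by linarith : 0 ≤ -b)]
    simp
  · rw [gammaMeasure_real_Ici_of_nonpos hk0 hl (by linarith), if_neg hb.not_gt]
    simp

lemma charFun_gammaMeasure_natCast {k : ℕ} (hk : 1 ≤ k) {l : ℝ} (hl : 0 < l) (u : ℝ) :
    charFun (gammaMeasure k l) u = ((l : ℂ) / (l - u * Complex.I)) ^ k := by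
  obtain ⟨j, rfl⟩ := Nat.exists_eq_succ_of_ne_zero (by omega : k ≠ 0)
  exact charFun_gammaMeasure_natCast_succ j hl u

lemma charFun_gammaMeasure_map_neg_natCast {k : ℕ} (hk : 1 ≤ k) {l : ℝ} (hl : 0 < l) (u : ℝ) :
    charFun ((gammaMeasure k l).map Neg.neg) u = ((l : ℂ) / (l + u * Complex.I)) ^ k := by
  have h : (Neg.neg : ℝ → ℝ) = fun x => -1 * x := by ext; simp
  rw [h, charFun_map_mul, charFun_gammaMeasure_natCast hk hl]
  push_cast
  congr 2
  ring

lemma gammaMeasure_withDensity_exp_natCast {k : ℕ} (hk : 1 ≤ k) {l s : ℝ} (hl : 0 < l)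
    (hs : s < l) :
    (gammaMeasure k l).withDensity (fun x => ENNReal.ofReal (Real.exp (s * x))) =
      ENNReal.ofReal ((l / (l - s)) ^ k) • gammaMeasure k (l - s) := by
  obtain ⟨j, rfl⟩ := Nat.exists_eq_succ_of_ne_zero (by omega : k ≠ 0)
  exact gammaMeasure_withDensity_exp j hl hs

lemma gammaMeasure_map_neg_withDensity_exp_natCast {k : ℕ} (hk : 1 ≤ k) {l s : ℝ} (hl : 0 < l)
    (hs : -l < s) :
    ((gammaMeasure k l).map Neg.neg).withDensity (fun x => ENNReal.ofReal (Real.exp (s * x))) =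
      ENNReal.ofReal ((l / (l + s)) ^ k) • (gammaMeasure k (l + s)).map Neg.neg := by
  have h := gammaMeasure_withDensity_exp_natCast hk hl (s := -s) (by linarith)
  rw [sub_neg_eq_add] at h
  rw [← Measure.map_smul, ← h]
  ext t ht
  rw [withDensity_apply _ ht, setLIntegral_map ht (by fun_prop) measurable_neg,
    Measure.map_apply measurable_neg ht, withDensity_apply _ (measurable_neg ht)]
  simp

/-! ### The compound Poisson law -/

/-- The contribution of the `P_{n,k}` to the law of a sum of `n` double exponential jumps. -/
noncomputable def kouJumpPos (p l₁ l₂ : ℝ) (n : ℕ) : Measure ℝ :=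
  ∑ k ∈ Finset.Icc 1 n, ENNReal.ofReal (kouP p l₁ l₂ n k) • gammaMeasure k l₁

/-- The contribution of the `Q_{n,k}` to the law of a sum of `n` double exponential jumps. -/
noncomputable def kouJumpNeg (p l₁ l₂ : ℝ) (n : ℕ) : Measure ℝ :=
  ∑ k ∈ Finset.Icc 1 n, ENNReal.ofReal (kouQ p l₁ l₂ n k) • (gammaMeasure k l₂).map Neg.neg

/-- The part of the compound Poisson law coming from the `P_{n,k}`. -/
noncomputable def kouLawPos (lam p l₁ l₂ T : ℝ) : Measure ℝ :=
  Measure.sum fun n : ℕ => ENNReal.ofReal (kouWeight lam T (n + 1)) • kouJumpPos p l₁ l₂ (n + 1)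

/-- The part of the compound Poisson law coming from the `Q_{n,k}`. -/
noncomputable def kouLawNeg (lam p l₁ l₂ T : ℝ) : Measure ℝ :=
  Measure.sum fun n : ℕ => ENNReal.ofReal (kouWeight lam T (n + 1)) • kouJumpNeg p l₁ l₂ (n + 1)

/-- The law at time `T` of the compound Poisson process with double exponential jumps. -/
noncomputable def kouLaw (lam p l₁ l₂ T : ℝ) : Measure ℝ :=
  ENNReal.ofReal (kouWeight lam T 0) • Measure.dirac 0 + kouLawPos lam p l₁ l₂ T +
    kouLawNeg lam p l₁ l₂ T

lemma kouWeight_nonneg {lam T : ℝ} (hlam : 0 ≤ lam) (hT : 0 ≤ T) (n : ℕ) :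
    0 ≤ kouWeight lam T n := by
  unfold kouWeight; positivity

lemma hasSum_kouWeight_mul_pow (lam T : ℝ) (z : ℂ) :
    HasSum (fun n => (kouWeight lam T n : ℂ) * z ^ n) (Complex.exp (lam * T * (z - 1))) := by
  have h := (NormedSpace.expSeries_div_hasSum_exp ((lam : ℂ) * T * z)).mul_left
    (Complex.exp (-(lam * T)))
  rw [← Complex.exp_eq_exp_ℂ, ← Complex.exp_add] at h
  have e1 : (fun n => (kouWeight lam T n : ℂ) * z ^ n) = fun n : ℕ =>
      Complex.exp (-(lam * T)) * (((lam : ℂ) * T * z) ^ n / (n.factorial : ℂ)) := by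
    ext n
    simp only [kouWeight]
    push_cast
    ring
  rw [e1, show (lam : ℂ) * T * (z - 1) = -(lam * T) + lam * T * z by ring]
  exact h

lemma hasSum_kouWeight (lam T : ℝ) : HasSum (kouWeight lam T) 1 := by
  have h := hasSum_kouWeight_mul_pow lam T 1
  simp only [one_pow, mul_one, sub_self, mul_zero, Complex.exp_zero] at h
  exact Complex.hasSum_ofReal.mp (by simpa using h)

lemma kouJump_univ {p l₁ l₂ : ℝ} (hp : 0 ≤ p) (hp1 : p ≤ 1) (hl₁ : 0 < l₁) (hl₂ : 0 < l₂)
    {n : ℕ} (hn : n ≠ 0) :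
    kouJumpPos p l₁ l₂ n Set.univ + kouJumpNeg p l₁ l₂ n Set.univ = 1 := by
  have hP := kouP_nonneg hp hp1 hl₁.le hl₂.le n
  have hQ := kouQ_nonneg hp hp1 hl₁.le hl₂.le n
  rw [← ENNReal.ofReal_one, ← sum_kouP_kouQ p (add_pos hl₁ hl₂).ne' hn, kouJumpPos, kouJumpNeg,
    Measure.finsetSum_apply, Measure.finsetSum_apply, ← Finset.sum_add_distrib,
    ENNReal.ofReal_sum_of_nonneg fun k _ => add_nonneg (hP k) (hQ k)]
  refine Finset.sum_congr rfl fun k hk => ?_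
  have hk0 : (0 : ℝ) < k := by exact_mod_cast (Finset.mem_Icc.mp hk).1
  have h1 := isProbabilityMeasure_gammaMeasure hk0 hl₁
  have h2 := isProbabilityMeasure_gammaMeasure hk0 hl₂
  rw [Measure.smul_apply, Measure.smul_apply, Measure.map_apply measurable_neg MeasurableSet.univ,
    Set.preimage_univ, measure_univ, measure_univ, ENNReal.ofReal_add (hP k) (hQ k)]
  simp

lemma isProbabilityMeasure_kouLaw {lam p l₁ l₂ T : ℝ} (hlam : 0 ≤ lam) (hp : 0 ≤ p) (hp1 : p ≤ 1)
    (hl₁ : 0 < l₁) (hl₂ : 0 < l₂) (hT : 0 ≤ T) : IsProbabilityMeasure (kouLaw lam p l₁ l₂ T) where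
  measure_univ := by
    have hw := kouWeight_nonneg hlam hT
    rw [kouLaw, kouLawPos, kouLawNeg, Measure.add_apply, Measure.add_apply, Measure.smul_apply,
      Measure.sum_apply _ MeasurableSet.univ, Measure.sum_apply _ MeasurableSet.univ, measure_univ,
      smul_eq_mul, mul_one, add_assoc, ← ENNReal.tsum_add, ← ENNReal.ofReal_one, ← (hasSum_kouWeight lam T).tsum_eq,
      ENNReal.ofReal_tsum_of_nonneg hw (hasSum_kouWeight lam T).summable,
      tsum_eq_zero_add' (f := fun n => ENNReal.ofReal (kouWeight lam T n)) ENNReal.summable]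
    congr 1
    refine tsum_congr fun n => ?_
    rw [Measure.smul_apply, Measure.smul_apply, smul_eq_mul, smul_eq_mul, ← mul_add,
      kouJump_univ hp hp1 hl₁ hl₂ n.succ_ne_zero, mul_one]

lemma isFiniteMeasure_kouLawPos {lam p l₁ l₂ T : ℝ} (hlam : 0 ≤ lam) (hp : 0 ≤ p) (hp1 : p ≤ 1)
    (hl₁ : 0 < l₁) (hl₂ : 0 < l₂) (hT : 0 ≤ T) : IsFiniteMeasure (kouLawPos lam p l₁ l₂ T) := by
  have := isProbabilityMeasure_kouLaw hlam hp hp1 hl₁ hl₂ hT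
  refine isFiniteMeasure_of_le (kouLaw lam p l₁ l₂ T) ?_
  exact (Measure.le_add_left le_rfl).trans (Measure.le_add_right le_rfl)

lemma isFiniteMeasure_kouLawNeg {lam p l₁ l₂ T : ℝ} (hlam : 0 ≤ lam) (hp : 0 ≤ p) (hp1 : p ≤ 1)
    (hl₁ : 0 < l₁) (hl₂ : 0 < l₂) (hT : 0 ≤ T) : IsFiniteMeasure (kouLawNeg lam p l₁ l₂ T) := by
  have := isProbabilityMeasure_kouLaw hlam hp hp1 hl₁ hl₂ hT
  exact isFiniteMeasure_of_le (kouLaw lam p l₁ l₂ T) (Measure.le_add_left le_rfl)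

lemma hasSum_measureReal_sum {α : Type*} {m : MeasurableSpace α} (μ : ℕ → Measure α)
    [IsFiniteMeasure (Measure.sum μ)] {s : Set α} (hs : MeasurableSet s) :
    HasSum (fun n => (μ n).real s) ((Measure.sum μ).real s) := by
  have h : ∑' n, μ n s ≠ ∞ := by
    rw [← Measure.sum_apply _ hs]; exact measure_ne_top _ _
  have h1 := (ENNReal.summable_toReal h).hasSum
  rw [← ENNReal.tsum_toReal_eq fun n => ENNReal.ne_top_of_tsum_ne_top h n] at h1
  rwa [measureReal_def, Measure.sum_apply _ hs]

/-- Each term is the mass that one component of the mixture gives to `[b, ∞)`, so convergence is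
countable additivity of a finite measure. -/
lemma hasSum_kouPosTerm {lam p l₁ l₂ T : ℝ} (hlam : 0 ≤ lam) (hp : 0 ≤ p) (hp1 : p ≤ 1)
    (hl₁ : 0 < l₁) (hl₂ : 0 < l₂) (hT : 0 ≤ T) (b : ℝ) :
    HasSum (fun n => kouPosTerm lam p l₁ l₂ b T (n + 1))
      ((kouLawPos lam p l₁ l₂ T).real (Set.Ici b)) := by
  have := isFiniteMeasure_kouLawPos hlam hp hp1 hl₁ hl₂ hT
  rw [kouLawPos] at this ⊢
  convert hasSum_measureReal_sum _ (measurableSet_Ici (a := b)) using 2 with n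
  rw [measureReal_ennreal_smul_apply, ENNReal.toReal_ofReal (kouWeight_nonneg hlam hT _), kouPosTerm,
    kouJumpPos, measureReal_def, Measure.finsetSum_apply, ENNReal.toReal_sum]
  · congr 1
    refine Finset.sum_congr rfl fun k hk => ?_
    rw [← measureReal_def, measureReal_ennreal_smul_apply,
      ENNReal.toReal_ofReal (kouP_nonneg hp hp1 hl₁.le hl₂.le _ _),
      gammaMeasure_real_Ici_natCast (Finset.mem_Icc.mp hk).1 hl₁]
  · intro k hk
    have hk0 : (0 : ℝ) < k := by exact_mod_cast (Finset.mem_Icc.mp hk).1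
    have h1 := isProbabilityMeasure_gammaMeasure hk0 hl₁
    exact ENNReal.mul_ne_top ENNReal.ofReal_ne_top (measure_ne_top _ _)
  · exact this

lemma hasSum_kouNegTerm {lam p l₁ l₂ T : ℝ} (hlam : 0 ≤ lam) (hp : 0 ≤ p) (hp1 : p ≤ 1)
    (hl₁ : 0 < l₁) (hl₂ : 0 < l₂) (hT : 0 ≤ T) (b : ℝ) :
    HasSum (fun n => kouNegTerm lam p l₁ l₂ b T (n + 1))
      ((kouLawNeg lam p l₁ l₂ T).real (Set.Ici b)) := by
  have := isFiniteMeasure_kouLawNeg hlam hp hp1 hl₁ hl₂ hT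
  rw [kouLawNeg] at this ⊢
  convert hasSum_measureReal_sum _ (measurableSet_Ici (a := b)) using 2 with n
  rw [measureReal_ennreal_smul_apply, ENNReal.toReal_ofReal (kouWeight_nonneg hlam hT _), kouNegTerm,
    kouJumpNeg, measureReal_def, Measure.finsetSum_apply, ENNReal.toReal_sum]
  · congr 1
    refine Finset.sum_congr rfl fun k hk => ?_
    rw [← measureReal_def, measureReal_ennreal_smul_apply,
      ENNReal.toReal_ofReal (kouQ_nonneg hp hp1 hl₁.le hl₂.le _ _),
      gammaMeasure_map_neg_real_Ici_natCast (Finset.mem_Icc.mp hk).1 hl₂, mul_assoc]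
  · intro k hk
    have hk0 : (0 : ℝ) < k := by exact_mod_cast (Finset.mem_Icc.mp hk).1
    have h1 := isProbabilityMeasure_gammaMeasure hk0 hl₂
    have h2 := Measure.isProbabilityMeasure_map (μ := gammaMeasure k l₂) measurable_neg.aemeasurable
    exact ENNReal.mul_ne_top ENNReal.ofReal_ne_top (measure_ne_top _ _)
  · exact this

/-- `Ψ` is the probability that drift plus jumps reach level `a`. The atom at `0`, for no jumps,
gives the indicator of `b ≤ 0`. -/
lemma kouPsi_eq_kouLaw_real_Ici {lam p l₁ l₂ T : ℝ} (hlam : 0 ≤ lam) (hp : 0 ≤ p) (hp1 : p ≤ 1)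
    (hl₁ : 0 < l₁) (hl₂ : 0 < l₂) (hT : 0 ≤ T) (μ a : ℝ) :
    kouPsi μ lam p l₁ l₂ a T = (kouLaw lam p l₁ l₂ T).real (Set.Ici (a - μ * T)) := by
  have := isFiniteMeasure_kouLawPos hlam hp hp1 hl₁ hl₂ hT
  have := isFiniteMeasure_kouLawNeg hlam hp hp1 hl₁ hl₂ hT
  rw [kouPsi, (hasSum_kouPosTerm hlam hp hp1 hl₁ hl₂ hT _).tsum_eq,
    (hasSum_kouNegTerm hlam hp hp1 hl₁ hl₂ hT _).tsum_eq, kouLaw, measureReal_def, measureReal_def,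
    measureReal_def, Measure.add_apply, Measure.add_apply, Measure.smul_apply,
    Measure.dirac_apply' _ measurableSet_Ici, ENNReal.toReal_add _ (measure_ne_top _ _),
    ENNReal.toReal_add _ (measure_ne_top _ _), smul_eq_mul, ENNReal.toReal_mul,
    ENNReal.toReal_ofReal (kouWeight_nonneg hlam hT _)]
  · congr 3
    simp only [Set.indicator, Set.mem_Ici]
    split_ifs <;> simp
  · refine ENNReal.mul_ne_top ENNReal.ofReal_ne_top ?_
    simp only [Set.indicator]; split_ifs <;> simp
  · refine ENNReal.add_ne_top.mpr ⟨ENNReal.mul_ne_top ENNReal.ofReal_ne_top ?_, measure_ne_top _ _⟩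
    simp only [Set.indicator]; split_ifs <;> simp

lemma kouPsiConverges {lam p l₁ l₂ T : ℝ} (hlam : 0 ≤ lam) (hp : 0 ≤ p) (hp1 : p ≤ 1)
    (hl₁ : 0 < l₁) (hl₂ : 0 < l₂) (hT : 0 ≤ T) (μ a : ℝ) :
    KouPsiConverges μ lam p l₁ l₂ a T :=
  ⟨(hasSum_kouPosTerm hlam hp hp1 hl₁ hl₂ hT _).summable,
    (hasSum_kouNegTerm hlam hp hp1 hl₁ hl₂ hT _).summable⟩

/-! ### Characteristic function -/

lemma integrable_cexp_mul_I (μ : Measure ℝ) [IsFiniteMeasure μ] (u : ℝ) :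
    Integrable (fun x : ℝ => Complex.exp (u * x * Complex.I)) μ := by
  refine (integrable_const (1 : ℝ)).mono (Continuous.aestronglyMeasurable (by fun_prop))
    (ae_of_all _ fun x => ?_)
  rw [← Complex.ofReal_mul, Complex.norm_exp_ofReal_mul_I, norm_one]

lemma hasSum_charFun_sum (μ : ℕ → Measure ℝ) [IsFiniteMeasure (Measure.sum μ)] (u : ℝ) :
    HasSum (fun n => charFun (μ n) u) (charFun (Measure.sum μ) u) := by
  simp_rw [charFun_apply_real]
  exact hasSum_integral_measure (integrable_cexp_mul_I _ u)

lemma charFun_add_measure (μ ν : Measure ℝ) [IsFiniteMeasure μ] [IsFiniteMeasure ν] (u : ℝ) :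
    charFun (μ + ν) u = charFun μ u + charFun ν u := by
  simp_rw [charFun_apply_real]
  exact integral_add_measure (integrable_cexp_mul_I _ u) (integrable_cexp_mul_I _ u)

lemma charFun_ofReal_smul {c : ℝ} (hc : 0 ≤ c) (μ : Measure ℝ) (u : ℝ) :
    charFun (ENNReal.ofReal c • μ) u = c * charFun μ u := by
  rw [charFun_apply_real, charFun_apply_real, integral_smul_measure, ENNReal.toReal_ofReal hc,
    Complex.real_smul]

lemma charFun_finsetSum {ι : Type*} (s : Finset ι) (μ : ι → Measure ℝ)
    (hμ : ∀ i ∈ s, IsFiniteMeasure (μ i)) (u : ℝ) :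
    charFun (∑ i ∈ s, μ i) u = ∑ i ∈ s, charFun (μ i) u := by
  simp_rw [charFun_apply_real]
  refine integral_finsetSum_measure fun i hi => ?_
  have := hμ i hi
  exact integrable_cexp_mul_I _ u

lemma isFiniteMeasure_ofReal_smul {α : Type*} {m : MeasurableSpace α} (c : ℝ) (μ : Measure α)
    [IsFiniteMeasure μ] : IsFiniteMeasure (ENNReal.ofReal c • μ) :=
  ⟨ENNReal.mul_lt_top ENNReal.ofReal_lt_top (measure_lt_top _ _)⟩

lemma charFun_kouJumpPos {p l₁ l₂ : ℝ} (hp : 0 ≤ p) (hp1 : p ≤ 1) (hl₁ : 0 < l₁) (hl₂ : 0 < l₂)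
    (n : ℕ) (u : ℝ) : charFun (kouJumpPos p l₁ l₂ n) u =
      ∑ k ∈ Finset.Icc 1 n, (kouP p l₁ l₂ n k : ℂ) * ((l₁ : ℂ) / (l₁ - u * Complex.I)) ^ k := by
  rw [kouJumpPos, charFun_finsetSum]
  · refine Finset.sum_congr rfl fun k hk => ?_
    rw [charFun_ofReal_smul (kouP_nonneg hp hp1 hl₁.le hl₂.le _ _),
      charFun_gammaMeasure_natCast (Finset.mem_Icc.mp hk).1 hl₁]
  · intro k hk
    have hk0 : (0 : ℝ) < k := by exact_mod_cast (Finset.mem_Icc.mp hk).1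
    have h1 := isProbabilityMeasure_gammaMeasure hk0 hl₁
    exact isFiniteMeasure_ofReal_smul _ _

lemma charFun_kouJumpNeg {p l₁ l₂ : ℝ} (hp : 0 ≤ p) (hp1 : p ≤ 1) (hl₁ : 0 < l₁) (hl₂ : 0 < l₂)
    (n : ℕ) (u : ℝ) : charFun (kouJumpNeg p l₁ l₂ n) u =
      ∑ k ∈ Finset.Icc 1 n, (kouQ p l₁ l₂ n k : ℂ) * ((l₂ : ℂ) / (l₂ + u * Complex.I)) ^ k := by
  rw [kouJumpNeg, charFun_finsetSum]
  · refine Finset.sum_congr rfl fun k hk => ?_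
    rw [charFun_ofReal_smul (kouQ_nonneg hp hp1 hl₁.le hl₂.le _ _),
      charFun_gammaMeasure_map_neg_natCast (Finset.mem_Icc.mp hk).1 hl₂]
  · intro k hk
    have hk0 : (0 : ℝ) < k := by exact_mod_cast (Finset.mem_Icc.mp hk).1
    have h1 := isProbabilityMeasure_gammaMeasure hk0 hl₂
    have h2 := Measure.isProbabilityMeasure_map (μ := gammaMeasure k l₂) measurable_neg.aemeasurable
    exact isFiniteMeasure_ofReal_smul _ _

lemma charFun_kouLaw {lam p l₁ l₂ T : ℝ} (hlam : 0 ≤ lam) (hp : 0 ≤ p) (hp1 : p ≤ 1)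
    (hl₁ : 0 < l₁) (hl₂ : 0 < l₂) (hT : 0 ≤ T) (u : ℝ) :
    charFun (kouLaw lam p l₁ l₂ T) u =
      Complex.exp (lam * T * (p * ((l₁ : ℂ) / (l₁ - u * Complex.I)) +
        (1 - p) * ((l₂ : ℂ) / (l₂ + u * Complex.I)) - 1)) := by
  have i1 := isFiniteMeasure_kouLawPos hlam hp hp1 hl₁ hl₂ hT
  have i2 := isFiniteMeasure_kouLawNeg hlam hp hp1 hl₁ hl₂ hT
  have i3 := isFiniteMeasure_ofReal_smul (kouWeight lam T 0) (Measure.dirac (0 : ℝ))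
  have hw := kouWeight_nonneg hlam hT
  set A : ℂ := (l₁ : ℂ) / (l₁ - u * Complex.I)
  set B : ℂ := (l₂ : ℂ) / (l₂ + u * Complex.I)
  -- The denominators add up to `l₁ + l₂` whatever `u` is, that is, `l₁ / A + l₂ / B = l₁ + l₂`.
  have hAB : A * B = ((l₂ / (l₁ + l₂) : ℝ) : ℂ) * A + ((l₁ / (l₁ + l₂) : ℝ) : ℂ) * B := by
    have h1 : (l₁ : ℂ) - u * Complex.I ≠ 0 := fun h => hl₁.ne' (by simpa using congrArg Complex.re h)
    have h2 : (l₂ : ℂ) + u * Complex.I ≠ 0 := fun h => hl₂.ne' (by simpa using congrArg Complex.re h)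
    have h3 : (l₁ : ℂ) + l₂ ≠ 0 := by exact_mod_cast (add_pos hl₁ hl₂).ne'
    simp only [A, B]
    push_cast
    field_simp
    ring
  have hP : HasSum (fun n : ℕ => (kouWeight lam T (n + 1) : ℂ) *
      ∑ k ∈ Finset.Icc 1 (n + 1), (kouP p l₁ l₂ (n + 1) k : ℂ) * A ^ k)
      (charFun (kouLawPos lam p l₁ l₂ T) u) := by
    rw [kouLawPos] at i1 ⊢
    convert hasSum_charFun_sum _ u using 2 with n
    · rw [charFun_ofReal_smul (hw _), charFun_kouJumpPos hp hp1 hl₁ hl₂]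
    · exact i1
  have hQ : HasSum (fun n : ℕ => (kouWeight lam T (n + 1) : ℂ) *
      ∑ k ∈ Finset.Icc 1 (n + 1), (kouQ p l₁ l₂ (n + 1) k : ℂ) * B ^ k)
      (charFun (kouLawNeg lam p l₁ l₂ T) u) := by
    rw [kouLawNeg] at i2 ⊢
    convert hasSum_charFun_sum _ u using 2 with n
    · rw [charFun_ofReal_smul (hw _), charFun_kouJumpNeg hp hp1 hl₁ hl₂]
    · exact i2
  have hS := hasSum_kouWeight_mul_pow lam T (p * A + (1 - p) * B)
  -- The term `n = 0` is split off: it is the atom at `0`, and the partial fraction identity needs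
  -- `n ≠ 0`.
  have h1 := (hasSum_nat_add_iff' 1).mpr hS
  have h2 : HasSum (fun n : ℕ => (kouWeight lam T (n + 1) : ℂ) * (p * A + (1 - p) * B) ^ (n + 1))
      (charFun (kouLawPos lam p l₁ l₂ T) u + charFun (kouLawNeg lam p l₁ l₂ T) u) := by
    convert hP.add hQ using 2 with n
    rw [← mul_add, ← Finset.sum_add_distrib, sum_kouP_kouQ_mul_pow p hAB n.succ_ne_zero]
  have h3 := h1.unique h2
  rw [kouLaw, charFun_add_measure, charFun_add_measure, charFun_ofReal_smul (hw 0), charFun_dirac,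
    add_assoc, ← h3]
  simp

/-! ### Exponential tilting -/

/-- Changing the intensity from `lam` to `lam * z` supplies the factor `z ^ n` of
`pow_mul_kouP_of_add_eq`; the exponential compensates the Poisson normalisation. -/
lemma kouWeight_mul_kouP {lam p p' l₁ l₂ l₁' l₂' z T : ℝ} (h3 : l₁' ≠ 0) (h4 : l₂' ≠ 0)
    (hl : l₁' + l₂' = l₁ + l₂)
    (hp : z * p' = p * (l₁ / l₁')) (hq : z * (1 - p') = (1 - p) * (l₂ / l₂'))
    {n k : ℕ} (hk : 1 ≤ k) (hkn : k ≤ n) :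
    kouWeight lam T n * (kouP p l₁ l₂ n k * (l₁ / l₁') ^ k) =
      Real.exp (lam * (z - 1) * T) * (kouWeight (lam * z) T n * kouP p' l₁' l₂' n k) := by
  have h := pow_mul_kouP_of_add_eq h3 h4 hl hp hq hk hkn
  have he : Real.exp (-(lam * T)) =
      Real.exp (lam * (z - 1) * T) * Real.exp (-(lam * z * T)) := by
    rw [← Real.exp_add]; congr 1; ring
  unfold kouWeight
  rw [he]
  linear_combination (-(Real.exp (lam * (z - 1) * T) * Real.exp (-(lam * z * T)) *
    (lam * T) ^ n / (n.factorial : ℝ))) * h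

lemma ofReal_smul_smul {α : Type*} {m : MeasurableSpace α} {a b : ℝ} (ha : 0 ≤ a) (μ : Measure α) :
    ENNReal.ofReal a • ENNReal.ofReal b • μ = ENNReal.ofReal (a * b) • μ := by
  rw [smul_smul, ENNReal.ofReal_mul ha]

lemma smul_measure_sum {α ι : Type*} {m : MeasurableSpace α} (c : ℝ≥0∞) (μ : ι → Measure α) :
    c • Measure.sum μ = Measure.sum fun i => c • μ i := by
  ext s hs
  simp [Measure.sum_apply _ hs, ENNReal.tsum_mul_left]

/-- The tilt moves the rate `l₁` down and `l₂` up by one, scaling the component of shape `k` by `(l₁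
/ (l₁ - 1)) ^ k` or `(l₂ / (l₂ + 1)) ^ k`. The sum of the rates is kept, so the weights rescale
consistently. The two hypotheses add up to `z` being the mean of `exp` of one jump. -/
lemma kouLaw_withDensity_exp {lam p p' l₁ l₂ z T : ℝ} (hlam : 0 ≤ lam) (hp : 0 ≤ p) (hp1 : p ≤ 1)
    (hl₁ : 1 < l₁) (hl₂ : 0 < l₂) (hT : 0 ≤ T) (hz : 0 ≤ z)
    (hpz : z * p' = p * (l₁ / (l₁ - 1))) (hqz : z * (1 - p') = (1 - p) * (l₂ / (l₂ + 1))) :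
    (kouLaw lam p l₁ l₂ T).withDensity (fun x => ENNReal.ofReal (Real.exp x)) =
      ENNReal.ofReal (Real.exp (lam * (z - 1) * T)) • kouLaw (lam * z) p' (l₁ - 1) (l₂ + 1) T := by
  have hw := kouWeight_nonneg hlam hT
  have hw' := kouWeight_nonneg (mul_nonneg hlam hz) hT
  have hP := kouP_nonneg hp hp1 (zero_le_one.trans hl₁.le) hl₂.le
  have hQ := kouQ_nonneg hp hp1 (zero_le_one.trans hl₁.le) hl₂.le
  have h3 : l₁ - 1 ≠ 0 := by linarith
  have h4 : l₂ + 1 ≠ 0 := by linarith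
  have he := (Real.exp_pos (lam * (z - 1) * T)).le
  have hsum : ∀ (s : Finset ℕ) (μ : ℕ → Measure ℝ) (f : ℝ → ℝ≥0∞),
      (∑ k ∈ s, μ k).withDensity f = ∑ k ∈ s, (μ k).withDensity f := by
    intro s μ f
    induction s using Finset.induction_on with
    | empty => simp
    | insert a s ha ih => rw [Finset.sum_insert ha, Finset.sum_insert ha,
        withDensity_add_measure, ih]
  rw [kouLaw, kouLaw, withDensity_add_measure, withDensity_add_measure, smul_add, smul_add]
  congr 1
  · congr 1
    · rw [withDensity_smul_measure, ofReal_smul_smul he]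
      have h1 : (Measure.dirac (0 : ℝ)).withDensity (fun x => ENNReal.ofReal (Real.exp x)) =
          Measure.dirac 0 := by
        ext s hs
        rw [withDensity_apply _ hs, ← lintegral_indicator hs,
          lintegral_dirac' _ (Measurable.indicator (by fun_prop) hs), Measure.dirac_apply' _ hs]
        simp [Set.indicator]
      rw [h1]
      congr 2
      simp only [kouWeight, pow_zero]
      rw [mul_one, mul_one, ← mul_div_assoc, ← Real.exp_add]
      congr 2; ring
    · rw [kouLawPos, kouLawPos, withDensity_sum, smul_measure_sum]
      congr 1
      ext1 n
      rw [withDensity_smul_measure, ofReal_smul_smul he, kouJumpPos, kouJumpPos, hsum,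
        Finset.smul_sum, Finset.smul_sum]
      refine Finset.sum_congr rfl fun k hk => ?_
      obtain ⟨hk1, hk2⟩ := Finset.mem_Icc.mp hk
      have h := gammaMeasure_withDensity_exp_natCast hk1 (zero_lt_one.trans hl₁) hl₁
      simp only [one_mul] at h
      rw [withDensity_smul_measure, h, ofReal_smul_smul (hP _ _), ofReal_smul_smul (hw _),
        ofReal_smul_smul (mul_nonneg he (hw' _)),
        kouWeight_mul_kouP h3 h4 (by ring) hpz hqz hk1 hk2,
        mul_assoc (Real.exp _)]
  · rw [kouLawNeg, kouLawNeg, withDensity_sum, smul_measure_sum]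
    congr 1
    ext1 n
    rw [withDensity_smul_measure, ofReal_smul_smul he, kouJumpNeg, kouJumpNeg, hsum,
      Finset.smul_sum, Finset.smul_sum]
    refine Finset.sum_congr rfl fun k hk => ?_
    obtain ⟨hk1, hk2⟩ := Finset.mem_Icc.mp hk
    have h := gammaMeasure_map_neg_withDensity_exp_natCast hk1 hl₂ (s := 1) (by linarith)
    simp only [one_mul] at h
    rw [withDensity_smul_measure, h, ofReal_smul_smul (hQ _ _), ofReal_smul_smul (hw _),
      ofReal_smul_smul (mul_nonneg he (hw' _)), kouQ_eq_kouP, kouQ_eq_kouP,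
      kouWeight_mul_kouP h4 h3 (by ring) hqz (by simpa using hpz) hk1 hk2,
        mul_assoc (Real.exp _)]

/-! ### The Lévy–Khintchine exponent of the double exponential density -/

lemma gammaMeasure_map_neg (a r : ℝ) :
    (gammaMeasure a r).map Neg.neg = volume.withDensity fun x => gammaPDF a r (-x) := by
  have hm : Measurable (gammaPDF a r) := (measurable_gammaPDFReal a r).ennreal_ofReal
  ext s hs
  rw [Measure.map_apply measurable_neg hs, gammaMeasure, withDensity_apply _ (measurable_neg hs),
    withDensity_apply _ hs,
    ← (Measure.measurePreserving_neg (volume : Measure ℝ)).setLIntegral_comp_preimage hs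
      (f := fun x => gammaPDF a r (-x)) (hm.comp measurable_neg)]
  simp

lemma withDensity_kouDensity {lam p q l₁ l₂ : ℝ} (hlam : 0 ≤ lam) (hp : 0 ≤ p) (hq : 0 ≤ q)
    (hl₁ : 0 < l₁) (hl₂ : 0 < l₂) :
    (volume.withDensity fun x => ENNReal.ofReal (kouDensity lam p q l₁ l₂ x)) =
      ENNReal.ofReal (lam * p) • gammaMeasure (1 : ℕ) l₁ +
        ENNReal.ofReal (lam * q) • (gammaMeasure (1 : ℕ) l₂).map Neg.neg := by
  have hm : ∀ l, Measurable (gammaPDF ((1 : ℕ) : ℝ) l) := fun l =>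
    (measurable_gammaPDFReal _ l).ennreal_ofReal
  have h1 : (0 : ℝ) < ((1 : ℕ) : ℝ) := by norm_num
  rw [gammaMeasure_map_neg, gammaMeasure, ← withDensity_smul _ (hm _),
    ← withDensity_smul (f := fun x => gammaPDF ((1 : ℕ) : ℝ) l₂ (-x)) _
      ((hm _).comp measurable_neg),
    ← withDensity_add_left ((hm _).const_smul _)]
  refine withDensity_congr_ae ?_
  -- At `x = 0` both gamma densities are positive while `kouDensity` has only its upper branch, so
  -- that point is excluded.
  have h0 : ∀ᵐ x : ℝ, x ≠ 0 := by
    simp [ae_iff]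
  filter_upwards [h0] with x hx
  simp only [Pi.add_apply, Pi.smul_apply, smul_eq_mul, gammaPDF]
  rw [← ENNReal.ofReal_mul (by positivity), ← ENNReal.ofReal_mul (by positivity),
    ← ENNReal.ofReal_add
      (mul_nonneg (by positivity) (gammaPDFReal_nonneg h1 hl₁ x))
      (mul_nonneg (by positivity) (gammaPDFReal_nonneg h1 hl₂ (-x)))]
  congr 1
  have e1 := gammaPDFReal_natCast_succ 0 l₁ x
  have e2 := gammaPDFReal_natCast_succ 0 l₂ (-x)
  rw [zero_add] at e1 e2
  rw [e1, e2, kouDensity]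
  rcases lt_or_gt_of_ne hx with h | h
  · rw [if_neg h.not_ge, if_neg h.not_ge, if_pos (by linarith)]
    simp
    ring
  · rw [if_pos h.le, if_pos h.le, if_neg (by linarith)]
    simp
    ring

lemma isFiniteMeasure_withDensity_kouDensity {lam p q l₁ l₂ : ℝ} (hlam : 0 ≤ lam) (hp : 0 ≤ p)
    (hq : 0 ≤ q) (hl₁ : 0 < l₁) (hl₂ : 0 < l₂) :
    IsFiniteMeasure (volume.withDensity fun x => ENNReal.ofReal (kouDensity lam p q l₁ l₂ x)) := by
  rw [withDensity_kouDensity hlam hp hq hl₁ hl₂]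
  have h1 : (0 : ℝ) < ((1 : ℕ) : ℝ) := by norm_num
  have i1 := isProbabilityMeasure_gammaMeasure h1 hl₁
  have i2 := isProbabilityMeasure_gammaMeasure h1 hl₂
  have i3 := isFiniteMeasure_ofReal_smul (lam * p) (gammaMeasure (1 : ℕ) l₁)
  have i4 := isFiniteMeasure_ofReal_smul (lam * q) ((gammaMeasure (1 : ℕ) l₂).map Neg.neg)
  infer_instance

lemma charFun_withDensity_kouDensity {lam p q l₁ l₂ : ℝ} (hlam : 0 ≤ lam) (hp : 0 ≤ p)
    (hq : 0 ≤ q) (hl₁ : 0 < l₁) (hl₂ : 0 < l₂) (u : ℝ) :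
    charFun (volume.withDensity fun x => ENNReal.ofReal (kouDensity lam p q l₁ l₂ x)) u =
      lam * (p * ((l₁ : ℂ) / (l₁ - u * Complex.I)) + q * ((l₂ : ℂ) / (l₂ + u * Complex.I))) := by
  rw [withDensity_kouDensity hlam hp hq hl₁ hl₂]
  have h1 : (0 : ℝ) < ((1 : ℕ) : ℝ) := by norm_num
  have i1 := isProbabilityMeasure_gammaMeasure h1 hl₁
  have i2 := isProbabilityMeasure_gammaMeasure h1 hl₂
  have i3 := isFiniteMeasure_ofReal_smul (lam * p) (gammaMeasure (1 : ℕ) l₁)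
  have i4 := isFiniteMeasure_ofReal_smul (lam * q) ((gammaMeasure (1 : ℕ) l₂).map Neg.neg)
  rw [charFun_add_measure, charFun_ofReal_smul (by positivity), charFun_ofReal_smul (by positivity),
    charFun_gammaMeasure_natCast le_rfl hl₁, charFun_gammaMeasure_map_neg_natCast le_rfl hl₂]
  push_cast
  ring

/-- For a finite Lévy measure the small-jump compensator is integrable and merges into the drift,
leaving a compound Poisson exponent. -/
lemma levyExponent_eq_charFun (γ : ℝ) (ν : Measure ℝ) [IsFiniteMeasure ν] (u : ℝ) :
    levyExponent γ 0 ν u =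
      ((γ - ∫ x, (if |x| ≤ 1 then x else 0) ∂ν : ℝ) : ℂ) * u * Complex.I +
        (charFun ν u - charFun ν 0) := by
  have hs : MeasurableSet {x : ℝ | |x| ≤ 1} := measurableSet_le (by fun_prop) measurable_const
  have hi : Integrable (fun x : ℝ => if |x| ≤ 1 then x else 0) ν := by
    refine (integrable_const (1 : ℝ)).mono
      (Measurable.ite hs measurable_id measurable_const).aestronglyMeasurable
      (ae_of_all _ fun x => ?_)
    split_ifs with h
    · simpa using h
    · simp
  have he : ∀ x : ℝ, (Complex.exp (Complex.I * u * x) - 1 -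
      if |x| ≤ 1 then Complex.I * u * x else 0) =
      Complex.exp (u * x * Complex.I) - Complex.exp ((0 : ℝ) * x * Complex.I) -
        Complex.I * u * ((if |x| ≤ 1 then x else 0 : ℝ) : ℂ) := by
    intro x
    rw [show Complex.I * u * x = u * x * Complex.I by ring]
    split_ifs <;> simp
    ring
  have h1 : Integrable (fun x : ℝ => Complex.exp (u * x * Complex.I) -
      Complex.exp ((0 : ℝ) * x * Complex.I)) ν :=
    (integrable_cexp_mul_I ν u).sub (integrable_cexp_mul_I ν 0)
  have h2 : Integrable (fun x : ℝ => Complex.I * u * ((if |x| ≤ 1 then x else 0 : ℝ) : ℂ)) ν :=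
    hi.ofReal.const_mul _
  rw [levyExponent, integral_congr_ae (ae_of_all _ he), integral_sub h1 h2,
    integral_sub (integrable_cexp_mul_I ν u) (integrable_cexp_mul_I ν 0), integral_const_mul,
    integral_complex_ofReal, ← charFun_apply_real, ← charFun_apply_real]
  push_cast
  ring

/-- The increments of a pure-jump Lévy process with double exponential density are a drift plus
a compound Poisson variable. -/
lemma exists_map_eq_kouLaw_map_add {Ω : Type*} {m : MeasurableSpace Ω} {P : Measure Ω}
    [IsProbabilityMeasure P] {ℱ : Filtration ℝ≥0 m} {X : ℝ≥0 → Ω → ℝ} {lam p q l₁ l₂ : ℝ}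
    (hlam : 0 ≤ lam) (hp : 0 ≤ p) (hq : 0 ≤ q) (hpq : p + q = 1) (hl₁ : 0 < l₁) (hl₂ : 0 < l₂)
    (hX : IsPureJumpLevyWithDensity X ℱ P (kouDensity lam p q l₁ l₂)) :
    ∃ c : ℝ, ∀ h : ℝ≥0, P.map (fun ω => X h ω - X 0 ω) =
      (kouLaw lam p l₁ l₂ h).map (fun x => x + c * h) := by
  obtain ⟨hL, γ, -, -, hchar⟩ := hX
  have hp1 : p ≤ 1 := by linarith
  set ν := volume.withDensity fun x => ENNReal.ofReal (kouDensity lam p q l₁ l₂ x) with hν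
  have hfin : IsFiniteMeasure ν := isFiniteMeasure_withDensity_kouDensity hlam hp hq hl₁ hl₂
  refine ⟨γ - ∫ x, (if |x| ≤ 1 then x else 0) ∂ν, fun h => ?_⟩
  set c := γ - ∫ x, (if |x| ≤ 1 then x else 0) ∂ν with hc
  have hmeas : ∀ s, Measurable (X s) := fun s => (hL.adapted s).mono (ℱ.le s) le_rfl
  have i1 : IsProbabilityMeasure (P.map fun ω => X h ω - X 0 ω) :=
    Measure.isProbabilityMeasure_map ((hmeas h).sub (hmeas 0)).aemeasurable
  have i2 := isProbabilityMeasure_kouLaw hlam hp hp1 hl₁ hl₂ h.coe_nonneg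
  have i3 : IsProbabilityMeasure ((kouLaw lam p l₁ l₂ h).map fun x => x + c * h) :=
    Measure.isProbabilityMeasure_map (by fun_prop)
  refine Measure.ext_of_charFun ?_
  ext u
  have h1 : (l₁ : ℂ) ≠ 0 := by exact_mod_cast hl₁.ne'
  have h2 : (l₂ : ℂ) ≠ 0 := by exact_mod_cast hl₂.ne'
  have hqp : (q : ℂ) = 1 - p := by rw [eq_sub_of_add_eq' hpq]; push_cast; ring
  rw [hchar, charFun_map_add_const, charFun_kouLaw hlam hp hp1 hl₁ hl₂ h.coe_nonneg,
    levyExponent_eq_charFun, ← hc, hν, charFun_withDensity_kouDensity hlam hp hq hl₁ hl₂,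
    charFun_withDensity_kouDensity hlam hp hq hl₁ hl₂, ← Complex.exp_add]
  congr 1
  simp only [Complex.ofReal_zero, zero_mul, sub_zero, add_zero, div_self h1, div_self h2,
    RCLike.inner_apply, conj_trivial]
  rw [hqp]
  push_cast
  ring

/-! ### Conditional expectation of a function of an independent variable -/

/-- The `m'`-measurable variable is frozen and the independent one integrated out. -/
lemma condExp_comp_prodMk_of_indep {Ω : Type*} {m' m : MeasurableSpace Ω} {P : Measure Ω}
    [IsProbabilityMeasure P] (hm : m' ≤ m) {X D : Ω → ℝ} (hX : Measurable[m'] X)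
    (hD : Measurable D) (hind : Indep (MeasurableSpace.comap D inferInstance) m' P)
    {f : ℝ × ℝ → ℝ} (hf : Measurable f) (hint : Integrable (fun ω => f (X ω, D ω)) P) :
    P[fun ω => f (X ω, D ω) | m'] =ᵐ[P] fun ω => ∫ x, f (X ω, x) ∂(P.map D) := by
  have hρ : IsProbabilityMeasure (P.map D) := Measure.isProbabilityMeasure_map hD.aemeasurable
  have hg : StronglyMeasurable fun x : ℝ => ∫ y, f (x, y) ∂(P.map D) :=
    StronglyMeasurable.integral_prod_right (f := fun x y => f (x, y)) hf.stronglyMeasurable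
  have hXm : Measurable X := hX.mono hm le_rfl
  have key : ∀ A : Set Ω, MeasurableSet[m'] A →
      Integrable (A.indicator fun ω => ∫ x, f (X ω, x) ∂(P.map D)) P ∧
      ∫ ω in A, (∫ x, f (X ω, x) ∂(P.map D)) ∂P = ∫ ω in A, f (X ω, D ω) ∂P := by
    intro A hA
    -- Packing the indicator of `A` with `X` makes the integral over `A` an integral against the
    -- product law of `Z` and `D`, where Fubini gives both integrability and the value.
    let Z : Ω → ℝ × ℝ := fun ω => (A.indicator (fun _ => 1) ω, X ω)
    have hZ' : Measurable[m'] Z := (measurable_const.indicator hA).prodMk hX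
    have hZ : Measurable Z := hZ'.mono hm le_rfl
    have hZD : IndepFun Z D P := by
      rw [IndepFun_iff_Indep]
      exact indep_of_indep_of_le_left hind.symm hZ'.comap_le
    have hmap := (indepFun_iff_map_prod_eq_prod_map_map hZ.aemeasurable hD.aemeasurable).mp hZD
    let F : (ℝ × ℝ) × ℝ → ℝ := fun w => w.1.1 * f (w.1.2, w.2)
    have hF : Measurable F := by fun_prop
    have hFZ : (fun ω => F (Z ω, D ω)) = A.indicator fun ω => f (X ω, D ω) := by
      ext ω
      by_cases h : ω ∈ A <;> simp [F, Z, h]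
    have hFint : Integrable F ((P.map Z).prod (P.map D)) := by
      rw [← hmap, integrable_map_measure hF.aestronglyMeasurable (hZ.prodMk hD).aemeasurable]
      exact (hint.indicator (hm _ hA)).congr (ae_of_all _ fun ω => (congrFun hFZ ω).symm)
    have hin : (fun ω => ∫ x, F (Z ω, x) ∂(P.map D)) =
        A.indicator fun ω => ∫ x, f (X ω, x) ∂(P.map D) := by
      ext ω
      by_cases h : ω ∈ A <;> simp [F, Z, h]
    have h1 := hFint.integral_prod_left
    rw [integrable_map_measure h1.aestronglyMeasurable hZ.aemeasurable] at h1
    refine ⟨hin ▸ h1, ?_⟩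
    rw [← integral_indicator (hm _ hA), ← integral_indicator (hm _ hA), ← hFZ, ← hin,
      ← integral_map (f := F) (hZ.prodMk hD).aemeasurable hF.aestronglyMeasurable, hmap,
      integral_prod _ hFint, integral_map hZ.aemeasurable hFint.integral_prod_left.aestronglyMeasurable]
  refine (ae_eq_condExp_of_forall_setIntegral_eq hm hint (fun A hA _ => ?_)
    (fun A hA _ => (key A hA).2) ?_).symm
  · exact (integrable_indicator_iff (hm _ hA)).mp (key A hA).1
  · exact (hg.comp_measurable hX).aestronglyMeasurable

/-! ### The call price -/

/-- `1 + ζ` is the mean of `exp` of one jump; it serves as the `z` of `kouLaw_withDensity_exp` and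
as the divisor in `p*`. -/
lemma one_add_kouZeta_pos {p q l₁ l₂ : ℝ} (hp : 0 ≤ p) (hq : 0 ≤ q) (hpq : p + q = 1)
    (hl₁ : 1 < l₁) (hl₂ : 0 < l₂) : 0 < 1 + kouZeta p q l₁ l₂ := by
  have h1 : 0 < l₁ - 1 := sub_pos.mpr hl₁
  have e : 1 + kouZeta p q l₁ l₂ = p * l₁ / (l₁ - 1) + q * l₂ / (l₂ + 1) := by
    rw [kouZeta]; ring
  rw [e]
  rcases hp.eq_or_lt with rfl | hp
  · have : q = 1 := by linarith
    subst this
    simp; positivity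
  · have : 0 ≤ q * l₂ / (l₂ + 1) := by positivity
    have : 0 < p * l₁ / (l₁ - 1) := by positivity
    positivity

lemma one_add_kouZeta_mul_kouPStar {p q l₁ l₂ : ℝ} (h : 1 + kouZeta p q l₁ l₂ ≠ 0) :
    (1 + kouZeta p q l₁ l₂) * kouPStar p q l₁ l₂ = p * (l₁ / (l₁ - 1)) := by
  rw [kouPStar]; field_simp

lemma one_add_kouZeta_mul_one_sub_kouPStar {p q l₁ l₂ : ℝ} (h : 1 + kouZeta p q l₁ l₂ ≠ 0) :
    (1 + kouZeta p q l₁ l₂) * (1 - kouPStar p q l₁ l₂) = q * (l₂ / (l₂ + 1)) := by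
  rw [mul_sub, one_add_kouZeta_mul_kouPStar h, kouZeta]; ring

/-- If the exponential of a shifted double exponential compound Poisson variable has mean one,
then the shift is `-lam * ζ * T` and the exponential tilt is again of the same type. -/
lemma drift_and_tilt_of_lintegral_exp_eq_one {lam p q l₁ l₂ T d : ℝ} (hlam : 0 ≤ lam) (hp : 0 ≤ p)
    (hq : 0 ≤ q) (hpq : p + q = 1) (hl₁ : 1 < l₁) (hl₂ : 0 < l₂) (hT : 0 ≤ T)
    (h : ∫⁻ x, ENNReal.ofReal (Real.exp x) ∂((kouLaw lam p l₁ l₂ T).map fun x => x + d) = 1) :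
    d = -lam * kouZeta p q l₁ l₂ * T ∧ ∀ a : ℝ,
      ∫⁻ x in Set.Ici a, ENNReal.ofReal (Real.exp x)
          ∂((kouLaw lam p l₁ l₂ T).map fun x => x + d) =
        kouLaw (kouLamStar lam p q l₁ l₂) (kouPStar p q l₁ l₂) (l₁ - 1) (l₂ + 1) T
          (Set.Ici (a - d)) := by
  have hz := one_add_kouZeta_pos hp hq hpq hl₁ hl₂
  have hp1 : p ≤ 1 := by linarith
  have hq' : q = 1 - p := by linarith
  have h1 := one_add_kouZeta_mul_kouPStar hz.ne'
  have h2 := one_add_kouZeta_mul_one_sub_kouPStar hz.ne'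
  set z := 1 + kouZeta p q l₁ l₂ with hzdef
  set p' := kouPStar p q l₁ l₂
  have hl₁' : 0 < l₁ - 1 := sub_pos.mpr hl₁
  have hp' : 0 ≤ p' := nonneg_of_mul_nonneg_right (h1 ▸ by positivity) hz
  have hp1' : p' ≤ 1 := sub_nonneg.mp (nonneg_of_mul_nonneg_right (h2 ▸ by positivity) hz)
  rw [hq'] at h2
  have htilt := kouLaw_withDensity_exp hlam hp hp1 hl₁ hl₂ hT hz.le h1 h2
  have hstar : kouLamStar lam p q l₁ l₂ = lam * z := by rw [kouLamStar, hzdef]; ring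
  have hprob := isProbabilityMeasure_kouLaw (mul_nonneg hlam hz.le) hp' hp1' hl₁'
    (add_pos hl₂ one_pos) hT
  have hset : ∀ s : Set ℝ, MeasurableSet s →
      ∫⁻ x in s, ENNReal.ofReal (Real.exp x) ∂((kouLaw lam p l₁ l₂ T).map fun x => x + d) =
        ENNReal.ofReal (Real.exp (d + lam * (z - 1) * T)) *
          kouLaw (lam * z) p' (l₁ - 1) (l₂ + 1) T ((fun x => x + d) ⁻¹' s) := by
    intro s hs
    have hs' : MeasurableSet ((fun x => x + d) ⁻¹' s) := measurable_add_const d hs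
    have e : ∀ x : ℝ, ENNReal.ofReal (Real.exp (x + d)) =
        ENNReal.ofReal (Real.exp d) * ENNReal.ofReal (Real.exp x) := by
      intro x
      rw [← ENNReal.ofReal_mul (Real.exp_pos d).le, ← Real.exp_add, add_comm]
    rw [setLIntegral_map hs (by fun_prop) (by fun_prop), lintegral_congr e,
      lintegral_const_mul _ (by fun_prop), ← withDensity_apply _ hs', htilt, Measure.smul_apply,
      smul_eq_mul, ← mul_assoc, ← ENNReal.ofReal_mul (Real.exp_pos d).le, ← Real.exp_add]
  -- Comparing total masses forces `exp (d + lam * (z - 1) * T) = 1`. This yields the drift and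
  -- removes the prefactor from the tail formula.
  have hu := hset Set.univ MeasurableSet.univ
  rw [setLIntegral_univ, h, Set.preimage_univ, measure_univ, mul_one, ← ENNReal.ofReal_one,
    ENNReal.ofReal_eq_ofReal_iff zero_le_one (Real.exp_pos _).le, eq_comm, Real.exp_eq_one_iff] at hu
  refine ⟨by rw [hzdef] at hu; linarith, fun a => ?_⟩
  rw [hset _ measurableSet_Ici, hu, Real.exp_zero, ENNReal.ofReal_one, one_mul, hstar]
  congr 1
  ext x
  simp

/-- The call payoff integrated against a law under which `exp` is integrable. -/
lemma integral_call_payoff {ρ : Measure ℝ} [IsFiniteMeasure ρ]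
    (hρ : Integrable Real.exp ρ) {s K : ℝ} (hs : 0 < s) (hK : 0 < K) :
    ∫ x, max (s * Real.exp x - K) 0 ∂ρ =
      s * (∫ x in Set.Ici (Real.log (K / s)), Real.exp x ∂ρ) -
        K * ρ.real (Set.Ici (Real.log (K / s))) := by
  have e : ∀ x : ℝ, max (s * Real.exp x - K) 0 =
      (Set.Ici (Real.log (K / s))).indicator (fun x => s * Real.exp x - K) x := by
    intro x
    have hiff : Real.log (K / s) ≤ x ↔ K ≤ s * Real.exp x := by
      rw [Real.log_le_iff_le_exp (by positivity), div_le_iff₀' hs]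
    by_cases h : x ∈ Set.Ici (Real.log (K / s))
    · rw [Set.indicator_of_mem h, max_eq_left (sub_nonneg.mpr (hiff.mp h))]
    · rw [Set.indicator_of_notMem h, max_eq_right]
      have := mt hiff.mpr h
      linarith
  rw [integral_congr_ae (ae_of_all _ e), integral_indicator measurableSet_Ici,
    integral_sub (hρ.const_mul s).integrableOn (integrable_const _), integral_const_mul,
    setIntegral_const, smul_eq_mul, mul_comm K]

theorem mainTheorem2 {Ω : Type*} {m : MeasurableSpace Ω} (P : Measure Ω) [IsProbabilityMeasure P]
    (ℱ : Filtration ℝ≥0 m) (S : ℝ≥0 → Ω → ℝ) (lam p q l₁ l₂ : ℝ)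
    (hlam : 0 ≤ lam) (hp : 0 ≤ p) (hq : 0 ≤ q) (hpq : p + q = 1) (hl₁ : 1 < l₁) (hl₂ : 0 < l₂)
    (hS : IsKouModel S ℱ P lam p q l₁ l₂)
    (K : ℝ) (hK : 0 < K) (t T : ℝ≥0) (htT : t ≤ T) :
    -- the payoff is integrable and the series defining `Ψ` converge
    Integrable (fun ω => max (S T ω - K) 0) P ∧
    (∀ a : ℝ,
      KouPsiConverges (-lam * kouZeta p q l₁ l₂) (kouLamStar lam p q l₁ l₂) (kouPStar p q l₁ l₂)
        (l₁ - 1) (l₂ + 1) a ((T : ℝ) - t) ∧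
      KouPsiConverges (-lam * kouZeta p q l₁ l₂) lam p l₁ l₂ a ((T : ℝ) - t)) ∧
    -- the pricing formula
    callPrice S ℱ P K T t =ᵐ[P] fun ω =>
      S t ω * kouPsi (-lam * kouZeta p q l₁ l₂) (kouLamStar lam p q l₁ l₂) (kouPStar p q l₁ l₂)
          (l₁ - 1) (l₂ + 1) (Real.log (K / S t ω)) ((T : ℝ) - t) -
        K * kouPsi (-lam * kouZeta p q l₁ l₂) lam p l₁ l₂ (Real.log (K / S t ω)) ((T : ℝ) - t) := by
  have hp1 : p ≤ 1 := by linarith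
  have hl₁0 : 0 < l₁ := zero_lt_one.trans hl₁
  have hl₁' : 0 < l₁ - 1 := sub_pos.mpr hl₁
  have hl₂' : 0 < l₂ + 1 := add_pos hl₂ one_pos
  have hz := one_add_kouZeta_pos hp hq hpq hl₁ hl₂
  have hp' : 0 ≤ kouPStar p q l₁ l₂ := nonneg_of_mul_nonneg_right
    (one_add_kouZeta_mul_kouPStar hz.ne' ▸ by positivity) hz
  have hp1' : kouPStar p q l₁ l₂ ≤ 1 := sub_nonneg.mp (nonneg_of_mul_nonneg_right
    (one_add_kouZeta_mul_one_sub_kouPStar hz.ne' ▸ by positivity) hz)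
  have hlam' : 0 ≤ kouLamStar lam p q l₁ l₂ := by
    rw [kouLamStar, add_comm]; exact mul_nonneg hlam hz.le
  have hcoe : ((T - t : ℝ≥0) : ℝ) = (T : ℝ) - t := NNReal.coe_sub htT
  have hτ : 0 ≤ (T : ℝ) - t := hcoe ▸ NNReal.coe_nonneg _
  have hint : ∀ u, Integrable (S u) P := hS.martingale.integrable
  have hpay : Integrable (fun ω => max (S T ω - K) 0) P :=
    ((hint T).sub (integrable_const K)).pos_part
  refine ⟨hpay, fun a => ⟨kouPsiConverges hlam' hp' hp1' hl₁' hl₂' hτ _ a,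
    kouPsiConverges hlam hp hp1 hl₁0 hl₂ hτ _ a⟩, ?_⟩
  obtain ⟨c, hc⟩ := exists_map_eq_kouLaw_map_add hlam hp hq hpq hl₁0 hl₂ hS.log_levy
  have hSt : Measurable[ℱ t] (S t) := (hS.martingale.1 t).measurable
  have hSm : ∀ u, Measurable (S u) := fun u => (hS.martingale.1 u).measurable.mono (ℱ.le u) le_rfl
  let D : Ω → ℝ := fun ω => Real.log (S T ω) - Real.log (S t ω)
  have hD : Measurable D := (hSm T).log.sub (hSm t).log
  have hind : Indep (MeasurableSpace.comap D inferInstance) (ℱ t) P :=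
    hS.log_levy.1.indep_increments t T htT
  have hST : ∀ ω, S T ω = S t ω * Real.exp (D ω) := by
    intro ω
    simp only [D]
    rw [Real.exp_sub, Real.exp_log (hS.pos T ω), Real.exp_log (hS.pos t ω),
      mul_div_cancel₀ _ (hS.pos t ω).ne']
  have hlaw : P.map D = (kouLaw lam p l₁ l₂ ((T : ℝ) - t)).map
      fun x => x + c * ((T : ℝ) - t) := by
    have h1 := (hS.log_levy.1.stationary_increments t (T - t)).map_eq
    rw [add_tsub_cancel_of_le htT, hc (T - t), hcoe] at h1
    exact h1
  have hρ : IsProbabilityMeasure (P.map D) := Measure.isProbabilityMeasure_map hD.aemeasurable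
  -- Independence gives `E[S_T] = E[S_t] E[exp D]`, the martingale property gives `E[S_T] = E[S_t]`,
  -- and this common value is positive and finite, so it cancels.
  have hone : ∫⁻ x, ENNReal.ofReal (Real.exp x) ∂(P.map D) = 1 := by
    rw [lintegral_map (by fun_prop) hD]
    have hi : IndepFun (fun ω => ENNReal.ofReal (S t ω))
        (fun ω => ENNReal.ofReal (Real.exp (D ω))) P := by
      have h0 : IndepFun (S t) D P := by
        rw [IndepFun_iff_Indep]
        exact indep_of_indep_of_le_left hind.symm hSt.comap_le
      exact h0.comp (φ := fun x => ENNReal.ofReal x) (ψ := fun x => ENNReal.ofReal (Real.exp x))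
        (by fun_prop) (by fun_prop)
    have hmul := lintegral_mul_eq_lintegral_mul_lintegral_of_indepFun''
      (hSm t).ennreal_ofReal.aemeasurable hD.exp.ennreal_ofReal.aemeasurable hi
    have hSTt : ∫⁻ ω, ENNReal.ofReal (S T ω) ∂P = ∫⁻ ω, ENNReal.ofReal (S t ω) ∂P := by
      rw [← ofReal_integral_eq_lintegral_ofReal (hint T) (ae_of_all _ fun ω => (hS.pos T ω).le),
        ← ofReal_integral_eq_lintegral_ofReal (hint t) (ae_of_all _ fun ω => (hS.pos t ω).le),
        ← integral_condExp (ℱ.le t), integral_congr_ae (hS.martingale.2 t T htT)]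
    have hpos : ∫⁻ ω, ENNReal.ofReal (S t ω) ∂P ≠ 0 := by
      rw [ne_eq, lintegral_eq_zero_iff (hSm t).ennreal_ofReal]
      intro h0
      obtain ⟨ω, hω⟩ := h0.exists
      exact (ENNReal.ofReal_pos.mpr (hS.pos t ω)).ne' hω
    have htop : ∫⁻ ω, ENNReal.ofReal (S t ω) ∂P ≠ ∞ := by
      rw [← ofReal_integral_eq_lintegral_ofReal (hint t) (ae_of_all _ fun ω => (hS.pos t ω).le)]
      exact ENNReal.ofReal_ne_top
    have e : ∀ ω, ENNReal.ofReal (S t ω) * ENNReal.ofReal (Real.exp (D ω)) =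
        ENNReal.ofReal (S T ω) := fun ω => by
      rw [hST ω, ENNReal.ofReal_mul (hS.pos t ω).le]
    rw [lintegral_congr e, hSTt] at hmul
    exact (ENNReal.mul_right_inj hpos htop).mp (by rw [← hmul, mul_one])
  have hexp : Integrable Real.exp (P.map D) := by
    refine ⟨Real.measurable_exp.aestronglyMeasurable, ?_⟩
    rw [hasFiniteIntegral_iff_ofReal (ae_of_all _ fun x => (Real.exp_pos x).le), hone]
    exact ENNReal.one_lt_top
  -- Only the product `c * (T - t)` is identified, which suffices even when `t = T`.
  obtain ⟨hd, htail⟩ := drift_and_tilt_of_lintegral_exp_eq_one hlam hp hq hpq hl₁ hl₂ hτ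
    (hlaw ▸ hone)
  have hcond := condExp_comp_prodMk_of_indep (ℱ.le t) hSt hD hind
    (f := fun w => max (w.1 * Real.exp w.2 - K) 0) (by fun_prop)
    (hpay.congr (ae_of_all _ fun ω => by simp only [hST ω]))
  simp only [← hST] at hcond
  refine hcond.trans (ae_of_all _ fun ω => ?_)
  simp only
  rw [integral_call_payoff hexp (hS.pos t ω) hK,
    kouPsi_eq_kouLaw_real_Ici hlam' hp' hp1' hl₁' hl₂' hτ,
    kouPsi_eq_kouLaw_real_Ici hlam hp hp1 hl₁0 hl₂ hτ, ← hd]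
  congr 2
  · rw [integral_eq_lintegral_of_nonneg_ae (ae_of_all _ fun x => (Real.exp_pos x).le)
      Real.measurable_exp.aestronglyMeasurable, hlaw, htail]
    rfl
  · rw [hlaw, measureReal_def, Measure.map_apply (by fun_prop) measurableSet_Ici, measureReal_def]
    congr 2
    ext x
    simp
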